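/- **Theorem.** Call a set $\gamma\subset\mathbb R^2$ a *convex curve* if it is the image of an interval under a continuous map and has a supporting line through each of its points (a line through the point such that $\gamma$ lies in one of the two closed half-planes bounded by it), and a *strictly convex curve* if, moreover, it contains no nondegenerate line segment. For a bounded strictly convex curve $\gamma$ and an integer $n\ge 1$ let $$k(\gamma,n)=\#\bigl(\gamma\cap(\tfrac1n\mathbb Z)^2\bigr),$$ which is finite. Then for every bounded strictly convex curve $\gamma$, $$k(\gamma,n)=o(n^{2/3})\qquad\text{as } n\to\infty .$$ Consequently there is no *universal Jarník curve*: there is no bounded strictly convex curve $\gamma$ for which, with some constant $c>0$, the inequality $k(\gamma,n)\ge c\,n^{2/3}$ holds for infinitely many positive integers $n$. -/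

import Mathlib

open Filter Asymptotics

/-- The Euclidean plane with a fixed Cartesian coordinate system. -/
abbrev Plane : Type := EuclideanSpace ℝ (Fin 2)

/-- A plane curve: the image of an interval (of any kind) under a continuous map to the plane. -/
def IsPlaneCurve (γ : Set Plane) : Prop :=
  ∃ (I : Set ℝ) (c : ℝ → Plane), I.Nonempty ∧ I.OrdConnected ∧ ContinuousOn c I ∧ c '' I = γ

/-- The line through `p` orthogonal to `ν ≠ 0` is a supporting line of `γ` at the point `p`:
it passes through `p`, and `γ` lies in one of the two closed half-planes it bounds. -/
def HasSupportingLineAt (γ : Set Plane) (p : Plane) : Prop :=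
  ∃ ν : Plane, ν ≠ 0 ∧ ∀ q ∈ γ, inner ℝ ν (q - p) ≤ 0

/-- A convex curve: a plane curve with a supporting line through each of its points. -/
def IsConvexCurve (γ : Set Plane) : Prop :=
  IsPlaneCurve γ ∧ ∀ p ∈ γ, HasSupportingLineAt γ p

/-- A strictly convex curve: a convex curve that contains no nondegenerate line segment. -/
def IsStrictlyConvexCurve (γ : Set Plane) : Prop :=
  IsConvexCurve γ ∧ ∀ p q : Plane, p ≠ q → ¬ segment ℝ p q ⊆ γ

/-- The lattice `(ℤ/n)²` of points both of whose coordinates lie in `(1/n)ℤ` (for `n ≥ 1`). -/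
def scaledLattice (n : ℕ) : Set Plane :=
  {p | ∀ i, ∃ a : ℤ, p i = (a : ℝ) / (n : ℝ)}

/-- The number `k(γ, n)` of points of `(ℤ/n)²` on `γ`. -/
noncomputable def latticeCount (γ : Set Plane) (n : ℕ) : ℕ :=
  (γ ∩ scaledLattice n).ncard

/-- A universal Jarník curve: a bounded strictly convex curve with `k(γ, n) ≥ c n^(2/3)`
for some constant `c > 0` and infinitely many positive integers `n`. -/
def IsUniversalJarnikCurve (γ : Set Plane) : Prop :=
  IsStrictlyConvexCurve γ ∧ Bornology.IsBounded γ ∧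
    ∃ c : ℝ, 0 < c ∧
      {n : ℕ | 0 < n ∧ c * (n : ℝ) ^ (2 / 3 : ℝ) ≤ (latticeCount γ n : ℝ)}.Infinite

/-!
Let `N = n^{1/3}`. The lattice points on `γ`, split according to four sectors of directions of a
supporting normal, become the vertices of lattice polygonal chains on the graph of one convex
function `f` (the supremum of supporting lines of slope in `[-1, 1]`), dilated by `n`. A strictly
convex curve has no three collinear points (`IsStrictlyConvexCurve.cross_ne_zero`), so the edges
`v₀, v₁, v₂, …` of such a chain are pairwise distinct. Counting distinct vectors already gives
`O(N²)` edges; the point is to gain an arbitrarily small factor.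

* All but a small proportion of `N²` edges have length comparable to `N` and bounded determinants
  with their two successors, and lie over a point where `f` has a second order expansion that is
  uniformly good on the scale of three consecutive edges. The last property holds because the right
  derivative of `f` is monotone, hence differentiable almost everywhere (`exists_sum_length_le`).
* Along such a triple of edges the slopes grow as on a parabola. The curvature cancels from the
  relation between the two increments, and what remains says that the ratio `a₁ / a₀` of the widths
  of `v₀` and `v₁` almost solves a quadratic equation with coefficients determined by the bounded
  integers `det (vᵢ, vⱼ)` (`exists_near_root_of_mem`). So this ratio is close to one of finitely many
  numbers `r`, while `det (v₀, v₁)` takes finitely many values.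
* Such vectors `v₀` are rare (`exists_card_companion_le`): if `p / q` approximates `r` well, then
  `w = q v₁ - p v₀` is a nonzero lattice vector much shorter than `N` with
  `det (v₀, w) = q det (v₀, v₁)`. For each `w` this confines `v₀` to a line, and summing over the
  few short `w` leaves at most `ε' N²` vectors.
-/

/-! ### No three points of a strictly convex curve are collinear -/

/-- Twice the signed area of the triangle `a b c`. -/
def cross (a b c : Plane) : ℝ :=
  (b 0 - a 0) * (c 1 - a 1) - (b 1 - a 1) * (c 0 - a 0)

lemma plane_ext {p q : Plane} (h0 : p 0 = q 0) (h1 : p 1 = q 1) : p = q := by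
  ext i
  fin_cases i
  · exact h0
  · exact h1

lemma inner_plane (p q : Plane) : inner ℝ p q = p 0 * q 0 + p 1 * q 1 := by
  simp [PiLp.inner_apply, Fin.sum_univ_two]
  ring

lemma continuous_coord (i : Fin 2) : Continuous fun q : Plane => q i := by
  fun_prop

lemma IsPlaneCurve.isPreconnected {γ : Set Plane} (h : IsPlaneCurve γ) : IsPreconnected γ := by
  obtain ⟨I, c, -, hI, hc, rfl⟩ := h
  exact (isPreconnected_iff_ordConnected.mpr hI).image c hc

lemma HasSupportingLineAt.exists_coord {γ : Set Plane} {p : Plane}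
    (h : HasSupportingLineAt γ p) :
    ∃ u v : ℝ, (u ≠ 0 ∨ v ≠ 0) ∧ ∀ q ∈ γ, u * (q 0 - p 0) + v * (q 1 - p 1) ≤ 0 := by
  obtain ⟨ν, hν, h⟩ := h
  refine ⟨ν 0, ν 1, ?_, fun q hq => ?_⟩
  · by_contra! hc
    exact hν (plane_ext (by simpa using hc.1) (by simpa using hc.2))
  · have := h q hq
    rwa [inner_plane] at this

/-- A point in the open triangle spanned by three points of a set has no supporting line. -/
lemma not_interior_triangle {γ : Set Plane} {a b c z : Plane} (ha : a ∈ γ) (hb : b ∈ γ)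
    (hc : c ∈ γ) (hz : HasSupportingLineAt γ z) (h1 : 0 < cross a b z) (h2 : 0 < cross b c z)
    (h3 : 0 < cross c a z) : False := by
  obtain ⟨u, v, huv, h⟩ := hz.exists_coord
  have ha' := h a ha
  have hb' := h b hb
  have hc' := h c hc
  set A := u * (a 0 - z 0) + v * (a 1 - z 1) with hA
  set B := u * (b 0 - z 0) + v * (b 1 - z 1) with hB
  set C := u * (c 0 - z 0) + v * (c 1 - z 1) with hC
  -- `z` is a positive barycentric combination of `a`, `b`, `c`
  have key : cross b c z * A + cross c a z * B + cross a b z * C = 0 := by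
    simp only [hA, hB, hC, cross]; ring
  have hA0 : A = 0 := by
    nlinarith [mul_nonneg h2.le (neg_nonneg.2 ha'), mul_nonneg h3.le (neg_nonneg.2 hb'),
      mul_nonneg h1.le (neg_nonneg.2 hc')]
  have hB0 : B = 0 := by
    nlinarith [mul_nonneg h2.le (neg_nonneg.2 ha'), mul_nonneg h3.le (neg_nonneg.2 hb'),
      mul_nonneg h1.le (neg_nonneg.2 hc')]
  have hu : u * cross a b z = 0 := by
    have : u * cross a b z = A * (b 1 - z 1) - B * (a 1 - z 1) := by
      simp only [hA, hB, cross]; ring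
    rw [this, hA0, hB0]; ring
  have hv : v * cross a b z = 0 := by
    have : v * cross a b z = B * (a 0 - z 0) - A * (b 0 - z 0) := by
      simp only [hA, hB, cross]; ring
    rw [this, hA0, hB0]; ring
  rcases huv with hu' | hv'
  · exact (mul_ne_zero hu' h1.ne') hu
  · exact (mul_ne_zero hv' h1.ne') hv

/-- A vector that is both parallel and orthogonal to `c - a ≠ 0` vanishes. -/
lemma eq_of_cross_eq_zero {a c p q : Plane} (hac : a ≠ c)
    (h1 : (c 0 - a 0) * (q 1 - p 1) - (c 1 - a 1) * (q 0 - p 0) = 0)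
    (h2 : (c 0 - a 0) * (q 0 - p 0) + (c 1 - a 1) * (q 1 - p 1) = 0) : q = p := by
  have hL : 0 < (c 0 - a 0) ^ 2 + (c 1 - a 1) ^ 2 := by
    by_contra! h
    refine hac (plane_ext ?_ ?_) <;> nlinarith [sq_nonneg (c 0 - a 0), sq_nonneg (c 1 - a 1)]
  refine plane_ext ?_ ?_
  · have : ((c 0 - a 0) ^ 2 + (c 1 - a 1) ^ 2) * (q 0 - p 0) = 0 := by
      linear_combination (c 0 - a 0) * h2 - (c 1 - a 1) * h1
    rcases mul_eq_zero.1 this with h | h <;> linarith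
  · have : ((c 0 - a 0) ^ 2 + (c 1 - a 1) ^ 2) * (q 1 - p 1) = 0 := by
      linear_combination (c 1 - a 1) * h2 + (c 0 - a 0) * h1
    rcases mul_eq_zero.1 this with h | h <;> linarith

/-- If a strictly convex curve lies on one side of the line through two of its points `a`, `c`,
then it has no point strictly between them: its points in the strip over an interval around `b`
whose ends are missed by the curve either lie on the line, or stay away from it, because near the
line they would be interior to a triangle with vertices on the curve. -/
lemma not_between_of_side {γ : Set Plane} (hγ : IsStrictlyConvexCurve γ) {a b c : Plane}
    (ha : a ∈ γ) (hb : b ∈ γ) (hc : c ∈ γ) (hac : a ≠ c) {t : ℝ} (ht0 : 0 < t) (ht1 : t < 1)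
    (hb0 : b 0 = a 0 + t * (c 0 - a 0)) (hb1 : b 1 = a 1 + t * (c 1 - a 1))
    (hside : ∀ q ∈ γ, 0 ≤ cross a c q) : False := by
  have hL : 0 < (c 0 - a 0) ^ 2 + (c 1 - a 1) ^ 2 := by
    by_contra! h
    refine hac (plane_ext ?_ ?_) <;> nlinarith [sq_nonneg (c 0 - a 0), sq_nonneg (c 1 - a 1)]
  set l := (c 0 - a 0) ^ 2 + (c 1 - a 1) ^ 2 with hl
  have hab : a ≠ b := by
    rintro rfl
    have : t * l = 0 := by
      have e0 : t * (c 0 - a 0) = 0 := by linarith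
      have e1 : t * (c 1 - a 1) = 0 := by linarith
      linear_combination (c 0 - a 0) * e0 + (c 1 - a 1) * e1
    exact (mul_pos ht0 hL).ne' this
  have hbc : b ≠ c := by
    rintro rfl
    have : (1 - t) * l = 0 := by
      have e0 : (1 - t) * (b 0 - a 0) = 0 := by linarith
      have e1 : (1 - t) * (b 1 - a 1) = 0 := by linarith
      linear_combination (b 0 - a 0) * e0 + (b 1 - a 1) * e1
    exact (mul_pos (by linarith) hL).ne' this
  -- points of the two halves of the segment missed by the curve
  obtain ⟨p, hp, hpγ⟩ := Set.not_subset.1 (hγ.2 a b hab)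
  obtain ⟨p', hp', hpγ'⟩ := Set.not_subset.1 (hγ.2 b c hbc)
  rw [segment_eq_image] at hp hp'
  obtain ⟨θ, ⟨hθ0, hθ1⟩, rfl⟩ := hp
  obtain ⟨θ', ⟨hθ0', hθ1'⟩, rfl⟩ := hp'
  set φ : Plane → ℝ := fun q => (q 0 - a 0) * (c 0 - a 0) + (q 1 - a 1) * (c 1 - a 1) with hφ
  have hφc : Continuous φ := by
    have := continuous_coord 0
    have := continuous_coord 1
    fun_prop
  have hcr : ∀ x y : Plane, Continuous (cross x y) := by
    intro x y
    have := continuous_coord 0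
    have := continuous_coord 1
    unfold cross
    fun_prop
  set s := θ * t with hs
  set s' := (1 - θ') * t + θ' with hs'
  have hs1 : ∀ q ∈ γ, cross a c q = 0 → φ q ≠ s * l := by
    intro q hq h1 h2
    refine hpγ ?_
    convert hq using 1
    symm
    refine eq_of_cross_eq_zero hac ?_ ?_
    · simp only [PiLp.add_apply, PiLp.smul_apply, smul_eq_mul, hb0, hb1]
      simp only [cross] at h1
      linear_combination h1
    · simp only [PiLp.add_apply, PiLp.smul_apply, smul_eq_mul, hb0, hb1]
      simp only [hφ, hs, hl] at h2
      linear_combination h2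
  have hs2 : ∀ q ∈ γ, cross a c q = 0 → φ q ≠ s' * l := by
    intro q hq h1 h2
    refine hpγ' ?_
    convert hq using 1
    symm
    refine eq_of_cross_eq_zero hac ?_ ?_
    · simp only [PiLp.add_apply, PiLp.smul_apply, smul_eq_mul, hb0, hb1]
      simp only [cross] at h1
      linear_combination h1
    · simp only [PiLp.add_apply, PiLp.smul_apply, smul_eq_mul, hb0, hb1]
      simp only [hφ, hs', hl] at h2
      linear_combination h2
  have cab : cross a c b = 0 := by simp only [cross, hb0, hb1]; ring
  have caa : cross a c a = 0 := by simp only [cross]; ring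
  have φa : φ a = 0 := by simp only [hφ]; ring
  have φb : φ b = t * l := by simp only [hφ, hb0, hb1, hl]; ring
  have hsb : s * l < φ b := by
    refine lt_of_le_of_ne ?_ (hs1 b hb cab).symm
    rw [φb]; exact mul_le_mul_of_nonneg_right (by nlinarith) hL.le
  have hsb' : φ b < s' * l := by
    refine lt_of_le_of_ne ?_ (hs2 b hb cab)
    rw [φb]; exact mul_le_mul_of_nonneg_right (by nlinarith) hL.le
  have hsa : φ a < s * l := by
    refine lt_of_le_of_ne ?_ (hs1 a ha caa)
    rw [φa]; positivity
  have hs'1 : s' ≤ 1 := by nlinarith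
  have hsp : 0 < s := by
    rw [φa] at hsa
    exact (pos_iff_pos_of_mul_pos hsa).2 hL
  set U : Set Plane := {q | 0 < cross a c q} ∪ ({q | φ q < s * l} ∪ {q | s' * l < φ q}) with hU
  have hUo : IsOpen U :=
    (isOpen_lt continuous_const (hcr a c)).union
      ((isOpen_lt hφc continuous_const).union (isOpen_lt continuous_const hφc))
  have hcover : ∀ q ∈ γ, q ∈ U ∨ (cross a c q = 0 ∧ s * l < φ q ∧ φ q < s' * l) := by
    intro q hq
    rcases (hside q hq).lt_or_eq with h | h
    · exact Or.inl (Or.inl h)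
    rcases lt_trichotomy (φ q) (s * l) with h1 | h1 | h1
    · exact Or.inl (Or.inr (Or.inl h1))
    · exact absurd h1 (hs1 q hq h.symm)
    rcases lt_trichotomy (φ q) (s' * l) with h2 | h2 | h2
    · exact Or.inr ⟨h.symm, h1, h2⟩
    · exact absurd h2 (hs2 q hq h.symm)
    · exact Or.inl (Or.inr (Or.inr h2))
  by_cases hex : ∃ q ∈ γ, 0 < cross a c q
  · obtain ⟨r, hr, hrpos⟩ := hex
    -- the part of the strip below the two sides of the triangle `a c r`
    set V : Set Plane := ({q | 0 < cross c r q} ∩ {q | 0 < cross r a q}) ∩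
      ({q | s * l < φ q} ∩ {q | φ q < s' * l}) with hV
    have hVo : IsOpen V :=
      ((isOpen_lt continuous_const (hcr c r)).inter (isOpen_lt continuous_const (hcr r a))).inter
        ((isOpen_lt continuous_const hφc).inter (isOpen_lt hφc continuous_const))
    have hon : ∀ q : Plane, cross a c q = 0 → s * l < φ q → φ q < s' * l → q ∈ V := by
      intro q h0 h1 h2
      have e1 : l * cross r a q = cross a c r * φ q := by
        have : l * cross r a q - cross a c r * φ q = - (cross a c q) *
          ((r 0 - a 0) * (c 0 - a 0) + (r 1 - a 1) * (c 1 - a 1)) := by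
          simp only [hl, hφ, cross]; ring
        rw [h0] at this; linarith
      have e2 : l * cross c r q = cross a c r * (l - φ q) := by
        have : l * cross c r q - cross a c r * (l - φ q) = cross a c q *
          ((r 0 - a 0) * (c 0 - a 0) + (r 1 - a 1) * (c 1 - a 1) - l) := by
          simp only [hl, hφ, cross]; ring
        rw [h0] at this; linarith
      have hq0 : 0 < φ q := lt_trans (mul_pos hsp hL) h1
      have hq1 : φ q < l := lt_of_lt_of_le h2 (by nlinarith)
      refine ⟨⟨?_, ?_⟩, h1, h2⟩
      · exact pos_of_mul_pos_right (e2 ▸ mul_pos hrpos (by linarith)) hL.le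
      · exact pos_of_mul_pos_right (e1 ▸ mul_pos hrpos hq0) hL.le
    have hsub : γ ⊆ U ∪ V := by
      intro q hq
      rcases hcover q hq with h | ⟨h0, h1, h2⟩
      · exact Or.inl h
      · exact Or.inr (hon q h0 h1 h2)
    obtain ⟨z, hzγ, hzU, hzV⟩ := hγ.1.1.isPreconnected U V hUo hVo hsub
      ⟨a, ha, Or.inr (Or.inl hsa)⟩ ⟨b, hb, hon b cab hsb hsb'⟩
    obtain ⟨⟨hz1, hz2⟩, hz3, hz4⟩ := hzV
    simp only [Set.mem_ofPred_eq] at hz1 hz2 hz3 hz4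
    rcases hzU with h | h | h
    · exact not_interior_triangle ha hc hr (hγ.1.2 z hzγ) h hz1 hz2
    · simp only [Set.mem_ofPred_eq] at h; linarith
    · simp only [Set.mem_ofPred_eq] at h; linarith
  · push Not at hex
    obtain ⟨z, hzγ, hzU, hzV⟩ := hγ.1.1.isPreconnected U ({q | s * l < φ q} ∩ {q | φ q < s' * l})
      hUo ((isOpen_lt continuous_const hφc).inter (isOpen_lt hφc continuous_const))
      (fun q hq => (hcover q hq).imp id fun h => ⟨h.2.1, h.2.2⟩)
      ⟨a, ha, Or.inr (Or.inl hsa)⟩ ⟨b, hb, hsb, hsb'⟩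
    obtain ⟨hz3, hz4⟩ := hzV
    simp only [Set.mem_ofPred_eq] at hz3 hz4
    rcases hzU with h | h | h
    · exact absurd h (not_lt.2 (hex z hzγ))
    · simp only [Set.mem_ofPred_eq] at h; linarith
    · simp only [Set.mem_ofPred_eq] at h; linarith

/-- A point of a strictly convex curve is never strictly between two others: its supporting line
would contain these, so that the curve would lie on one side of the line through them. -/
lemma not_between {γ : Set Plane} (hγ : IsStrictlyConvexCurve γ) {a b c : Plane}
    (ha : a ∈ γ) (hb : b ∈ γ) (hc : c ∈ γ) (hac : a ≠ c) {t : ℝ} (ht0 : 0 < t) (ht1 : t < 1)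
    (hb0 : b 0 = a 0 + t * (c 0 - a 0)) (hb1 : b 1 = a 1 + t * (c 1 - a 1)) : False := by
  obtain ⟨u, v, huv, h⟩ := (hγ.1.2 b hb).exists_coord
  -- the supporting line at `b` contains `a` and `c`
  have h0 : u * (c 0 - a 0) + v * (c 1 - a 1) = 0 := by
    have h1 := h a ha
    have h2 := h c hc
    rw [hb0, hb1] at h1 h2
    have h1' : 0 ≤ t * (u * (c 0 - a 0) + v * (c 1 - a 1)) := by linarith
    have h2' : (1 - t) * (u * (c 0 - a 0) + v * (c 1 - a 1)) ≤ 0 := by linarith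
    refine le_antisymm ?_ ?_
    · by_contra! hcon
      exact absurd (mul_pos (by linarith : 0 < 1 - t) hcon) (not_lt.2 h2')
    · by_contra! hcon
      exact absurd (mul_neg_of_pos_of_neg ht0 hcon) (not_lt.2 h1')
  have hL : 0 < (c 0 - a 0) ^ 2 + (c 1 - a 1) ^ 2 := by
    by_contra! h
    refine hac (plane_ext ?_ ?_) <;> nlinarith [sq_nonneg (c 0 - a 0), sq_nonneg (c 1 - a 1)]
  set k := u * (c 1 - a 1) - v * (c 0 - a 0) with hk
  have hk0 : k ≠ 0 := by
    intro hk0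
    have hu : u * ((c 0 - a 0) ^ 2 + (c 1 - a 1) ^ 2) = 0 := by
      linear_combination (c 0 - a 0) * h0 + (c 1 - a 1) * hk0
    have hv : v * ((c 0 - a 0) ^ 2 + (c 1 - a 1) ^ 2) = 0 := by
      linear_combination (c 1 - a 1) * h0 - (c 0 - a 0) * hk0
    rcases huv with h | h
    · exact mul_ne_zero h hL.ne' hu
    · exact mul_ne_zero h hL.ne' hv
  have hq : ∀ q ∈ γ, 0 ≤ k * cross a c q := by
    intro q hq
    have := h q hq
    have e : k * cross a c q = -((c 0 - a 0) ^ 2 + (c 1 - a 1) ^ 2) *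
        (u * (q 0 - b 0) + v * (q 1 - b 1)) := by
      simp only [hk, cross, hb0, hb1]
      linear_combination ((q 0 - a 0) * (c 0 - a 0) + (q 1 - a 1) * (c 1 - a 1)
        - t * ((c 0 - a 0) ^ 2 + (c 1 - a 1) ^ 2)) * h0
    rw [e]; nlinarith
  rcases lt_or_gt_of_ne hk0 with hneg | hpos
  · refine not_between_of_side hγ hc hb ha hac.symm (t := 1 - t) (by linarith) (by linarith)
      (by linarith) (by linarith) fun q hq' => ?_
    have e : cross c a q = - cross a c q := by simp only [cross]; ring
    have := hq q hq'
    rw [e]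
    by_contra! hcon
    nlinarith
  · refine not_between_of_side hγ ha hb hc hac ht0 ht1 hb0 hb1 fun q hq' => ?_
    exact nonneg_of_mul_nonneg_right (hq q hq') hpos

lemma IsStrictlyConvexCurve.cross_ne_zero {γ : Set Plane} (hγ : IsStrictlyConvexCurve γ)
    {a b c : Plane} (ha : a ∈ γ) (hb : b ∈ γ) (hc : c ∈ γ) (hab : a ≠ b) (hbc : b ≠ c)
    (hac : a ≠ c) : cross a b c ≠ 0 := by
  intro h
  obtain ⟨t, ht0, ht1⟩ : ∃ t : ℝ, c 0 = a 0 + t * (b 0 - a 0) ∧ c 1 = a 1 + t * (b 1 - a 1) := by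
    simp only [cross] at h
    by_cases h0 : b 0 - a 0 = 0
    · have h1 : b 1 - a 1 ≠ 0 := fun h1 => hab (plane_ext (by linarith) (by linarith))
      refine ⟨(c 1 - a 1) / (b 1 - a 1), ?_, by field_simp; ring⟩
      rw [h0] at h ⊢
      have : c 0 - a 0 = 0 := by
        have : (b 1 - a 1) * (c 0 - a 0) = 0 := by linarith
        exact (mul_eq_zero.1 this).resolve_left h1
      linarith
    · refine ⟨(c 0 - a 0) / (b 0 - a 0), by field_simp; ring, ?_⟩
      field_simp
      linarith
  have t0 : t ≠ 0 := by
    rintro rfl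
    exact hac (plane_ext (by linarith) (by linarith))
  have t1 : t ≠ 1 := by
    rintro rfl
    exact hbc (plane_ext (by linarith) (by linarith))
  rcases lt_or_gt_of_ne t0 with hn | hp
  · have h1t : (1 : ℝ) - t ≠ 0 := by linarith
    refine not_between hγ hc ha hb hbc.symm (t := -t / (1 - t))
      (div_pos (by linarith) (by linarith)) ((div_lt_one (by linarith)).2 (by linarith)) ?_ ?_
    · rw [ht0]; field_simp; ring
    · rw [ht1]; field_simp; ring
  rcases lt_or_gt_of_ne t1 with hn1 | hp1
  · exact not_between hγ ha hc hb hab hp hn1 ht0 ht1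
  · refine not_between hγ ha hb hc hac (t := 1 / t) (by positivity)
      ((div_lt_one hp).2 hp1) ?_ ?_
    · rw [ht0]; field_simp; ring
    · rw [ht1]; field_simp; ring

/-! ### Counting lattice vectors with a companion of prescribed determinant and ratio -/

/-- Lattice vectors `v` on a line `det (v, w) = e` whose direction `w` is divisible by at most `d`
are spaced by at least `|w₁| / d` in the first coordinate. -/
lemma card_le_of_det_eq {w₁ w₂ e d : ℤ} (hd : 0 < d) (hw : w₁ ≠ 0)
    (hg : ∃ x y : ℤ, d = x * w₁ + y * w₂) {M : ℝ} (hM : 0 ≤ M) (S : Finset (ℤ × ℤ))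
    (hS : ∀ v ∈ S, 0 < v.1 ∧ (v.1 : ℝ) ≤ M ∧ v.1 * w₂ - v.2 * w₁ = e) :
    (S.card : ℝ) ≤ d * M / |(w₁ : ℝ)| + 1 := by
  have hwpos : 0 < |w₁| := abs_pos.2 hw
  have hwpos' : 0 < |(w₁ : ℝ)| := by exact_mod_cast hwpos
  have hd' : (0 : ℝ) < d := by exact_mod_cast hd
  obtain ⟨x, y, hxy⟩ := hg
  have hcard : S.card ≤ (Finset.Icc 0 ⌊d * M / |(w₁ : ℝ)|⌋).card := by
    refine Finset.card_le_card_of_injOn (fun v => d * v.1 / |w₁|) ?_ ?_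
    · intro v hv
      obtain ⟨h1, h2, h3⟩ := hS v hv
      simp only [Finset.coe_Icc, Set.mem_Icc]
      refine ⟨Int.ediv_nonneg (by positivity) hwpos.le, Int.le_floor.2 ?_⟩
      rw [le_div_iff₀ hwpos']
      have : d * v.1 / |w₁| * |w₁| ≤ d * v.1 := Int.ediv_mul_le _ hwpos.ne'
      have h : ((d * v.1 / |w₁| : ℤ) : ℝ) * |(w₁ : ℝ)| ≤ d * v.1 := by exact_mod_cast this
      exact h.trans (mul_le_mul_of_nonneg_left h2 hd'.le)
    · intro v hv v' hv' heq
      obtain ⟨h1, h2, h3⟩ := hS v hv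
      obtain ⟨h1', h2', h3'⟩ := hS v' hv'
      simp only at heq
      have hdvd : w₁ ∣ d * v.1 - d * v'.1 := by
        refine ⟨x * (v.1 - v'.1) + y * (v.2 - v'.2), ?_⟩
        rw [hxy]
        linear_combination y * (h3 - h3')
      have hmod : d * v.1 % |w₁| = d * v'.1 % |w₁| :=
        Int.emod_eq_emod_iff_emod_sub_eq_zero.2
          (Int.emod_eq_zero_of_dvd ((abs_dvd _ _).2 hdvd))
      have e1 : d * v.1 = d * v'.1 := by
        rw [← Int.mul_ediv_add_emod (d * v.1) |w₁|, ← Int.mul_ediv_add_emod (d * v'.1) |w₁|,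
          heq, hmod]
      have e2 : v.1 = v'.1 := mul_left_cancel₀ hd.ne' e1
      have e3 : v.2 * w₁ = v'.2 * w₁ := by rw [e2] at h3; linarith
      exact Prod.ext e2 (mul_right_cancel₀ hw e3)
  have hfl : (0 : ℤ) ≤ ⌊d * M / |(w₁ : ℝ)|⌋ := Int.floor_nonneg.2 (by positivity)
  have hcard' : ((Finset.Icc 0 ⌊d * M / |(w₁ : ℝ)|⌋).card : ℤ) = ⌊d * M / |(w₁ : ℝ)|⌋ + 1 := by
    rw [Int.card_Icc]; omega
  have : ((Finset.Icc 0 ⌊d * M / |(w₁ : ℝ)|⌋).card : ℝ) = (⌊d * M / |(w₁ : ℝ)|⌋ : ℝ) + 1 := by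
    exact_mod_cast hcard'
  calc (S.card : ℝ) ≤ ((Finset.Icc 0 ⌊d * M / |(w₁ : ℝ)|⌋).card : ℝ) := by exact_mod_cast hcard
    _ = (⌊d * M / |(w₁ : ℝ)|⌋ : ℝ) + 1 := this
    _ ≤ _ := by linarith [Int.floor_le (d * M / |(w₁ : ℝ)|)]

/-- Among the `O(N²)` lattice vectors `v = (a, b)` of size comparable to `N`, only a small
proportion has a lattice vector `v' = (a', b')` with `det (v, v') = d` and `a' / a` close to a given
number `r`. If `p / q` is a good rational approximation of `r`, then `w = q v' - p v` is a short
nonzero vector with `det (v, w) = q d`, and few vectors `v` satisfy this for each `w`. -/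
lemma exists_card_companion_le (r : ℝ) {C ε ε' : ℝ} {d : ℤ} (hC : 0 < C) (hε : 0 < ε)
    (hε' : 0 < ε') (hd : 0 < d) :
    ∃ η > 0, ∃ N₀ : ℝ, ∀ N ≥ N₀, ∀ S : Finset (ℤ × ℤ),
      (∀ v ∈ S, ε * N < v.1 ∧ (v.1 : ℝ) ≤ C * N ∧ |v.2| ≤ v.1 ∧
        ∃ v' : ℤ × ℤ, v.1 * v'.2 - v.2 * v'.1 = d ∧ |(v'.1 : ℝ) - r * v.1| ≤ η * N) →
      (S.card : ℝ) ≤ ε' * N ^ 2 := by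
  classical
  have hd' : (0 : ℝ) < d := by exact_mod_cast hd
  obtain ⟨Q, hQ⟩ := exists_nat_gt (12 * C ^ 2 * (d + 2) / ε')
  have hQr : (0 : ℝ) < Q := lt_of_le_of_lt (by positivity) hQ
  have hQn : 0 < Q := by exact_mod_cast hQr
  have hQ1 : (1 : ℝ) ≤ Q := by exact_mod_cast hQn
  refine ⟨C / Q ^ 2, by positivity, Q * d / ε + 1, fun N hN S hS => ?_⟩
  have hNpos : 0 < N := lt_of_lt_of_le (by positivity) hN
  have hNd : Q * d < ε * N := by
    have : Q * d / ε < N := by linarith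
    rw [div_lt_iff₀ hε] at this; linarith
  obtain ⟨f, hf, hfQ⟩ := Real.exists_rat_abs_sub_le_and_den_le r hQn
  set q : ℤ := (f.den : ℤ) with hq
  set p : ℤ := f.num with hp
  have hqpos : 0 < q := by simpa [hq] using f.den_pos
  have hqr : (0 : ℝ) < q := by exact_mod_cast hqpos
  have hqQ : (q : ℝ) ≤ Q := by simp only [hq]; exact_mod_cast hfQ
  have hpq : |q * r - p| ≤ 1 / Q := by
    have hfe : (f : ℝ) = p / q := by
      rw [Rat.cast_def]; simp [hp, hq]
    have hden : (f.den : ℝ) = q := by simp [hq]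
    rw [hfe, hden] at hf
    have e : q * r - p = q * (r - p / q) := by field_simp
    rw [e, abs_mul, abs_of_pos hqr]
    calc q * |r - p / q| ≤ q * (1 / ((Q + 1) * q)) := mul_le_mul_of_nonneg_left hf hqr.le
      _ = 1 / (Q + 1) := by field_simp
      _ ≤ 1 / Q := one_div_le_one_div_of_le hQr (by linarith)
  obtain ⟨x, y, hxy⟩ : ∃ x y : ℤ, x * p + y * q = 1 := by
    have : IsCoprime p q := by
      rw [Int.isCoprime_iff_gcd_eq_one, Int.gcd]
      simpa [hp, hq] using f.reduced
    exact this
  set M : ℝ := 2 * C * N / Q with hM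
  have hMpos : 0 < M := by positivity
  have hMN : M ≤ 2 * C * N := div_le_self (by positivity) hQ1
  set I : Finset ℤ := (Finset.Icc (-⌊M⌋) ⌊M⌋).erase 0 with hI
  set A : ℤ → ℤ → Finset (ℤ × ℤ) := fun w₁ w₂ => S.filter fun v =>
    v.1 * w₂ - v.2 * w₁ = q * d ∧ ∃ x y : ℤ, d = x * w₁ + y * w₂ with hA
  have hcover : S ⊆ I.biUnion fun w₁ => (Finset.Icc (-|w₁|) |w₁|).biUnion fun w₂ => A w₁ w₂ := by
    intro v hv
    obtain ⟨h1, h2, h3, v', h4, h5⟩ := hS v hv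
    have hapos : (0 : ℝ) < v.1 := lt_trans (by positivity) h1
    have hapos' : 0 < v.1 := by exact_mod_cast hapos
    set w₁ := q * v'.1 - p * v.1 with hw₁
    set w₂ := q * v'.2 - p * v.2 with hw₂
    have hdet : v.1 * w₂ - v.2 * w₁ = q * d := by
      rw [← h4, hw₁, hw₂]; ring
    have hqd : q * d < v.1 := by
      have : (q : ℝ) * d < v.1 :=
        lt_of_le_of_lt (mul_le_mul_of_nonneg_right hqQ hd'.le) (hNd.trans h1)
      exact_mod_cast this
    have hw₂le : |w₂| ≤ |w₁| := by
      have e : v.1 * |w₂| = |q * d + v.2 * w₁| := by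
        rw [← hdet, sub_add_cancel, abs_mul, abs_of_pos hapos']
      have : |q * d + v.2 * w₁| ≤ q * d + v.1 * |w₁| := by
        refine (abs_add_le _ _).trans ?_
        rw [abs_of_pos (mul_pos hqpos hd), abs_mul]
        have := mul_le_mul_of_nonneg_right h3 (abs_nonneg w₁)
        linarith
      have h : v.1 * |w₂| < v.1 * (|w₁| + 1) := by linarith
      exact Int.lt_add_one_iff.1 (lt_of_mul_lt_mul_left h hapos'.le)
    have hw₁0 : w₁ ≠ 0 := by
      intro h0
      have h0' : w₂ = 0 := by
        rw [h0, abs_zero] at hw₂le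
        exact abs_nonpos_iff.1 hw₂le
      rw [h0, h0'] at hdet
      have := mul_pos hqpos hd
      linarith
    have hw₁M : |(w₁ : ℝ)| ≤ M := by
      have e : (w₁ : ℝ) = q * (v'.1 - r * v.1) + (q * r - p) * v.1 := by
        rw [hw₁]; push_cast; ring
      rw [e]
      refine (abs_add_le _ _).trans ?_
      rw [abs_mul, abs_mul, abs_of_pos hqr, abs_of_pos hapos]
      have t1 : q * |(v'.1 : ℝ) - r * v.1| ≤ Q * (C / Q ^ 2 * N) :=
        mul_le_mul hqQ h5 (abs_nonneg _) hQr.le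
      have t2 : |q * r - p| * (v.1 : ℝ) ≤ 1 / Q * (C * N) :=
        mul_le_mul hpq h2 hapos.le (by positivity)
      have t3 : Q * (C / Q ^ 2 * N) + 1 / Q * (C * N) = M := by rw [hM]; field_simp; ring
      linarith
    have hw₁M' : |w₁| ≤ ⌊M⌋ := Int.le_floor.2 (by exact_mod_cast hw₁M)
    refine Finset.mem_biUnion.2 ⟨w₁, ?_, Finset.mem_biUnion.2 ⟨w₂, ?_, ?_⟩⟩
    · rw [hI, Finset.mem_erase, Finset.mem_Icc]
      exact ⟨hw₁0, abs_le.1 hw₁M'⟩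
    · rw [Finset.mem_Icc]
      exact abs_le.1 hw₂le
    · rw [hA, Finset.mem_filter]
      refine ⟨hv, hdet, -x * v'.2 - y * v.2, x * v'.1 + y * v.1, ?_⟩
      rw [hw₁, hw₂]
      linear_combination (-d) * hxy - (x * p + y * q) * h4
  have hinner : ∀ w₁ ∈ I,
      (((Finset.Icc (-|w₁|) |w₁|).biUnion fun w₂ => A w₁ w₂).card : ℝ) ≤
        3 * d * C * N + 3 * M := by
    intro w₁ hw₁
    rw [hI, Finset.mem_erase, Finset.mem_Icc] at hw₁
    obtain ⟨hw0, hwM⟩ := hw₁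
    have hwM' : |(w₁ : ℝ)| ≤ M := by
      have := Int.le_floor.1 (abs_le.2 hwM)
      exact_mod_cast this
    have hw1 : (1 : ℝ) ≤ |(w₁ : ℝ)| := by exact_mod_cast Int.one_le_abs hw0
    have hw1' : (0 : ℝ) < |(w₁ : ℝ)| := by linarith
    have hAle : ∀ w₂ ∈ Finset.Icc (-|w₁|) |w₁|,
        ((A w₁ w₂).card : ℝ) ≤ d * (C * N) / |(w₁ : ℝ)| + 1 := by
      intro w₂ _
      by_cases hg : ∃ x y : ℤ, d = x * w₁ + y * w₂
      · refine card_le_of_det_eq hd hw0 hg (by positivity) (A w₁ w₂) (e := q * d) ?_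
        intro v hv
        rw [hA, Finset.mem_filter] at hv
        obtain ⟨hv1, hv2, -⟩ := hv
        obtain ⟨h1, h2, -⟩ := hS v hv1
        refine ⟨?_, h2, hv2⟩
        have : (0 : ℝ) < v.1 := lt_trans (by positivity) h1
        exact_mod_cast this
      · have : A w₁ w₂ = ∅ := by
          rw [hA]
          exact Finset.filter_eq_empty_iff.2 fun v _ h => hg h.2
        rw [this, Finset.card_empty, Nat.cast_zero]
        positivity
    have hIcc : ((Finset.Icc (-|w₁|) |w₁|).card : ℝ) ≤ 3 * |(w₁ : ℝ)| := by
      have : ((Finset.Icc (-|w₁|) |w₁|).card : ℤ) = 2 * |w₁| + 1 := by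
        rw [Int.card_Icc]
        have := abs_nonneg w₁
        omega
      have h : ((Finset.Icc (-|w₁|) |w₁|).card : ℝ) = 2 * |(w₁ : ℝ)| + 1 := by
        exact_mod_cast this
      rw [h]; linarith
    calc (((Finset.Icc (-|w₁|) |w₁|).biUnion fun w₂ => A w₁ w₂).card : ℝ)
        ≤ ((∑ w₂ ∈ Finset.Icc (-|w₁|) |w₁|, (A w₁ w₂).card : ℕ) : ℝ) := by
          exact_mod_cast Finset.card_biUnion_le
      _ = ∑ w₂ ∈ Finset.Icc (-|w₁|) |w₁|, ((A w₁ w₂).card : ℝ) := by push_cast; rfl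
      _ ≤ ((Finset.Icc (-|w₁|) |w₁|).card : ℝ) * (d * (C * N) / |(w₁ : ℝ)| + 1) := by
          rw [← nsmul_eq_mul]
          exact Finset.sum_le_card_nsmul _ _ _ hAle
      _ ≤ 3 * |(w₁ : ℝ)| * (d * (C * N) / |(w₁ : ℝ)| + 1) :=
          mul_le_mul_of_nonneg_right hIcc (by positivity)
      _ = 3 * d * C * N + 3 * |(w₁ : ℝ)| := by field_simp
      _ ≤ 3 * d * C * N + 3 * M := by linarith
  have hIcard : (I.card : ℝ) ≤ 2 * M := by
    have hfl : 0 ≤ ⌊M⌋ := Int.floor_nonneg.2 hMpos.le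
    have : (I.card : ℤ) = 2 * ⌊M⌋ := by
      rw [hI, Finset.card_erase_of_mem (by rw [Finset.mem_Icc]; omega), Int.card_Icc]
      omega
    have h : (I.card : ℝ) = 2 * (⌊M⌋ : ℝ) := by exact_mod_cast this
    rw [h]
    linarith [Int.floor_le M]
  calc (S.card : ℝ)
      ≤ ((I.biUnion fun w₁ => (Finset.Icc (-|w₁|) |w₁|).biUnion fun w₂ => A w₁ w₂).card : ℝ) := by
        exact_mod_cast Finset.card_le_card hcover
    _ ≤ ((∑ w₁ ∈ I, ((Finset.Icc (-|w₁|) |w₁|).biUnion fun w₂ => A w₁ w₂).card : ℕ) : ℝ) := by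
        exact_mod_cast Finset.card_biUnion_le
    _ = ∑ w₁ ∈ I, (((Finset.Icc (-|w₁|) |w₁|).biUnion fun w₂ => A w₁ w₂).card : ℝ) := by
        push_cast; rfl
    _ ≤ (I.card : ℝ) * (3 * d * C * N + 3 * M) := by
        rw [← nsmul_eq_mul]
        exact Finset.sum_le_card_nsmul _ _ _ hinner
    _ ≤ 2 * M * (3 * d * C * N + 3 * M) := mul_le_mul_of_nonneg_right hIcard (by positivity)
    _ ≤ 2 * M * (3 * d * C * N + 3 * (2 * C * N)) := by gcongr
    _ = 12 * C ^ 2 * (d + 2) / Q * N ^ 2 := by rw [hM]; field_simp; ring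
    _ ≤ ε' * N ^ 2 := by
        refine mul_le_mul_of_nonneg_right ?_ (by positivity)
        rw [div_lt_iff₀ hε'] at hQ
        rw [div_le_iff₀ hQr]
        linarith

/-! ### Second order expansions of a convex function -/

/-- The points at which `f` has a second order expansion with error at most `δ h²`, valid for all
increments `h` with `|h| ≤ 1 / (m + 1)`. -/
def quadApproxSet (f : ℝ → ℝ) (δ : ℝ) (m : ℕ) : Set ℝ :=
  {x | ∃ A B : ℝ, ∀ h : ℝ, |h| ≤ 1 / ((m : ℝ) + 1) →
    |f (x + h) - f x - A * h - B * h ^ 2| ≤ δ * h ^ 2}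

lemma quadApproxSet_mono (f : ℝ → ℝ) (δ : ℝ) : Monotone (quadApproxSet f δ) := by
  rintro m m' hm x ⟨A, B, h⟩
  refine ⟨A, B, fun t ht => h t (ht.trans ?_)⟩
  have : (m : ℝ) ≤ m' := by exact_mod_cast hm
  exact one_div_le_one_div_of_le (by positivity) (by linarith)

lemma exists_mem_quadApproxSet {f : ℝ → ℝ} (hf : ConvexOn ℝ Set.univ f) (hfc : Continuous f)
    {x δ : ℝ} (hδ : 0 < δ)
    (hx : DifferentiableAt ℝ (fun x => derivWithin f (Set.Ioi x) x) x) :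
    ∃ m, x ∈ quadApproxSet f δ m := by
  set g := fun x => derivWithin f (Set.Ioi x) x with hg
  obtain ⟨κ, hκ⟩ : ∃ κ, HasDerivAt g κ x := ⟨_, hx.hasDerivAt⟩
  have hfg : ∀ s, HasDerivWithinAt f (g s) (Set.Ici s) s := fun s =>
    hasDerivWithinAt_Ioi_iff_Ici.1
      (hf.hasDerivWithinAt_rightDeriv_of_mem_interior (x := s) (by simp))
  have hlo := (hasDerivAt_iff_isLittleO.1 hκ).def hδ
  obtain ⟨ρ, hρ, hball⟩ := Metric.eventually_nhds_iff.1 hlo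
  obtain ⟨m, hm⟩ := exists_nat_one_div_lt hρ
  -- the remainder of the expansion has a small right derivative
  set E : ℝ → ℝ := fun s => f s - g x * (s - x) - κ / 2 * (s - x) ^ 2 with hE
  have hEc : Continuous E := by fun_prop
  have hEd : ∀ s, HasDerivWithinAt E (g s - g x - (s - x) * κ) (Set.Ici s) s := by
    intro s
    have h1 : HasDerivWithinAt (fun s => g x * (s - x)) (g x * 1) (Set.Ici s) s :=
      (((hasDerivAt_id s).sub_const x).const_mul (g x)).hasDerivWithinAt
    have h2 : HasDerivWithinAt (fun s => κ / 2 * (s - x) ^ 2)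
        (κ / 2 * (((2 : ℕ) : ℝ) * (s - x) ^ (2 - 1) * 1)) (Set.Ici s) s :=
      ((((hasDerivAt_id s).sub_const x).pow 2).const_mul (κ / 2)).hasDerivWithinAt
    have h3 := ((hfg s).sub h1).sub h2
    have e : g s - g x - (s - x) * κ =
        g s - g x * 1 - κ / 2 * (((2 : ℕ) : ℝ) * (s - x) ^ (2 - 1) * 1) := by
      norm_num
      ring
    rw [e]
    exact h3
  have hEb : ∀ s, |s - x| < ρ → ‖g s - g x - (s - x) * κ‖ ≤ δ * |s - x| := by
    intro s hs
    have := hball (y := s) (by rwa [Real.dist_eq])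
    simpa using this
  have hEx : E x = f x := by simp [hE]
  refine ⟨m, g x, κ / 2, fun h hh => ?_⟩
  have hhρ : |h| < ρ := lt_of_le_of_lt hh hm
  have e : f (x + h) - f x - g x * h - κ / 2 * h ^ 2 = E (x + h) - E x := by
    rw [hEx]; simp only [hE, add_sub_cancel_left]; ring
  rw [e]
  rcases le_total 0 h with h0 | h0
  · have := norm_image_sub_le_of_norm_deriv_right_le_segment (f := E)
      (f' := fun s => g s - g x - (s - x) * κ) (a := x) (b := x + h) (C := δ * |h|)
      hEc.continuousOn (fun s _ => hEd s) (fun s hs => ?_) (x + h)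
      (Set.right_mem_Icc.2 (by linarith))
    · rw [Real.norm_eq_abs, add_sub_cancel_left, abs_of_nonneg h0] at this
      linarith
    · have hs' : |s - x| ≤ |h| := by
        rw [abs_of_nonneg (by linarith [hs.1]), abs_of_nonneg h0]; linarith [hs.2]
      exact (hEb s (lt_of_le_of_lt hs' hhρ)).trans (mul_le_mul_of_nonneg_left hs' hδ.le)
  · have := norm_image_sub_le_of_norm_deriv_right_le_segment (f := E)
      (f' := fun s => g s - g x - (s - x) * κ) (a := x + h) (b := x) (C := δ * |h|)
      hEc.continuousOn (fun s _ => hEd s) (fun s hs => ?_) x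
      (Set.right_mem_Icc.2 (by linarith))
    · rw [Real.norm_eq_abs, abs_sub_comm, abs_of_nonpos h0] at this
      linarith
    · have hs' : |s - x| ≤ |h| := by
        rw [abs_of_nonpos (by linarith [hs.2]), abs_of_nonpos h0]; linarith [hs.1]
      exact (hEb s (lt_of_le_of_lt hs' hhρ)).trans (mul_le_mul_of_nonneg_left hs' hδ.le)

/-- A convex function is almost everywhere twice differentiable in the sense of a second order
expansion (the theorem of Alexandrov in dimension one), since its right derivative is monotone. -/
lemma ae_exists_mem_quadApproxSet {f : ℝ → ℝ} (hf : ConvexOn ℝ Set.univ f) (hfc : Continuous f)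
    {δ : ℝ} (hδ : 0 < δ) : ∀ᵐ x : ℝ, ∃ m, x ∈ quadApproxSet f δ m := by
  have hmono : Monotone fun x => derivWithin f (Set.Ioi x) x := by
    have := hf.monotoneOn_rightDeriv
    rwa [interior_univ, monotoneOn_univ] at this
  filter_upwards [hmono.ae_differentiableAt] with x hx
  exact exists_mem_quadApproxSet hf hfc hδ hx

/-- Disjoint intervals that miss `quadApproxSet f δ m` have small total length if `m` is large.
The set need not be shown measurable: continuity from below holds for its outer measure. -/
lemma exists_sum_length_le {f : ℝ → ℝ} (hf : ConvexOn ℝ Set.univ f) (hfc : Continuous f)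
    (R : ℝ) {δ μ : ℝ} (hδ : 0 < δ) (hμ : 0 < μ) :
    ∃ m : ℕ, ∀ (s : Finset ℕ) (l u : ℕ → ℝ), (∀ i ∈ s, l i ≤ u i) →
      (s : Set ℕ).PairwiseDisjoint (fun i => Set.Ico (l i) (u i)) →
      (∀ i ∈ s, Set.Ico (l i) (u i) ⊆ Set.Icc (-R) R) →
      (∀ i ∈ s, Disjoint (Set.Ico (l i) (u i)) (quadApproxSet f δ m)) →
      ∑ i ∈ s, (u i - l i) ≤ μ := by
  set ν := MeasureTheory.volume.restrict (Set.Icc (-R) R) with hν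
  have hfin : ν Set.univ ≠ ⊤ := by
    simp [hν]
  have htend := MeasureTheory.tendsto_measure_iUnion_atTop (μ := ν) (quadApproxSet_mono f δ)
  have hfull : ν (⋃ m, quadApproxSet f δ m) = ν Set.univ := by
    refine MeasureTheory.measure_congr ?_
    have : ∀ᵐ x ∂ν, ∃ m, x ∈ quadApproxSet f δ m :=
      MeasureTheory.ae_restrict_of_ae (ae_exists_mem_quadApproxSet hf hfc hδ)
    rw [eventuallyEq_univ]
    filter_upwards [this] with x hx
    exact Set.mem_iUnion.2 hx
  rw [hfull] at htend
  have hev : ∀ᶠ m in atTop, ν Set.univ < ν (quadApproxSet f δ m) + ENNReal.ofReal μ := by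
    have ht : Tendsto (fun m => ν (quadApproxSet f δ m) + ENNReal.ofReal μ) atTop
        (nhds (ν Set.univ + ENNReal.ofReal μ)) := by
      exact htend.add tendsto_const_nhds
    exact ht.eventually_const_lt (ENNReal.lt_add_right hfin (by simpa using hμ))
  obtain ⟨m, hm⟩ := hev.exists
  refine ⟨m, fun s l u hlu hdisj hsub hG => ?_⟩
  have hU : MeasurableSet (⋃ i ∈ s, Set.Ico (l i) (u i)) :=
    Finset.measurableSet_biUnion _ fun i _ => measurableSet_Ico
  have hUν : ν (⋃ i ∈ s, Set.Ico (l i) (u i)) = ENNReal.ofReal (∑ i ∈ s, (u i - l i)) := by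
    rw [MeasureTheory.measure_biUnion_finset hdisj fun i _ => measurableSet_Ico,
      ENNReal.ofReal_sum_of_nonneg fun i hi => sub_nonneg.2 (hlu i hi)]
    refine Finset.sum_congr rfl fun i hi => ?_
    rw [hν, MeasureTheory.Measure.restrict_apply measurableSet_Ico,
      Set.inter_eq_left.2 (hsub i hi), Real.volume_Ico]
  have hd : Disjoint (quadApproxSet f δ m) (⋃ i ∈ s, Set.Ico (l i) (u i)) := by
    rw [Set.disjoint_iUnion₂_right]
    exact fun i hi => (hG i hi).symm
  have hle : ν (quadApproxSet f δ m) + ν (⋃ i ∈ s, Set.Ico (l i) (u i)) ≤ ν Set.univ := by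
    rw [← MeasureTheory.measure_union hd hU]
    exact MeasureTheory.measure_mono (Set.subset_univ _)
  have hlt : ENNReal.ofReal (∑ i ∈ s, (u i - l i)) < ENNReal.ofReal μ := by
    rw [← hUν]
    refine lt_of_add_lt_add_left (lt_of_le_of_lt hle hm)
  exact ((ENNReal.ofReal_lt_ofReal_iff hμ).1 hlt).le

/-! ### Short runs of edges over a point with a second order expansion -/

/-- A number at which a quadratic polynomial with leading coefficient at least `1` is small lies near
the real part of one of its two roots. -/
lemma exists_near_root {A : ℝ} (hA : 1 ≤ A) (B C : ℝ) :
    ∃ r : Bool → ℝ, ∀ ρ τ : ℝ, 0 ≤ τ → |A * ρ ^ 2 + B * ρ + C| ≤ τ ^ 2 →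
      ∃ b, |ρ - r b| ≤ τ := by
  have hA0 : (0 : ℝ) < A := by linarith
  set e := -B / (2 * A) with he
  set c := C / A - e ^ 2 with hc
  -- for `c > 0` the square root has the junk value `0`, which is what is needed
  set s := Real.sqrt (-c) with hs
  refine ⟨fun b => if b then e + s else e - s, fun ρ τ hτ h => ?_⟩
  have h1 : |(ρ - e) ^ 2 + c| ≤ τ ^ 2 := by
    have e1 : A * ρ ^ 2 + B * ρ + C = A * ((ρ - e) ^ 2 + c) := by
      rw [hc, he]; field_simp; ring
    rw [e1, abs_mul, abs_of_pos hA0] at h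
    nlinarith [abs_nonneg ((ρ - e) ^ 2 + c)]
  rcases le_total 0 c with h0 | h0
  · have hs0 : s = 0 := Real.sqrt_eq_zero_of_nonpos (by linarith)
    refine ⟨true, ?_⟩
    simp only [hs0, if_true, add_zero]
    refine abs_le_of_sq_le_sq ?_ hτ
    linarith [le_abs_self ((ρ - e) ^ 2 + c)]
  · have hs2 : s ^ 2 = -c := Real.sq_sqrt (by linarith)
    have hprod : |ρ - (e + s)| * |ρ - (e - s)| ≤ τ * τ := by
      rw [← abs_mul]
      have : (ρ - (e + s)) * (ρ - (e - s)) = (ρ - e) ^ 2 + c := by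
        linear_combination -hs2
      rw [this]; linarith
    by_contra! hcon
    have ht := hcon true
    have hf := hcon false
    simp only [if_true, Bool.false_eq_true, if_false] at ht hf
    exact absurd (mul_lt_mul'' ht hf hτ hτ) (not_lt.2 hprod)

/-- Consecutive slopes over points near a point with a second order expansion grow as they do for
a parabola: in proportion to the distances `X₂ - X₀` and `X₃ - X₁`. -/
lemma slope_estimate {f : ℝ → ℝ} {δ x H ℓ X₀ X₁ X₂ X₃ : ℝ} {m : ℕ} (hδ : 0 < δ)
    (hx : x ∈ quadApproxSet f δ m) (hH : H ≤ 1 / ((m : ℝ) + 1)) (hℓ : 0 < ℓ)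
    (h0 : |X₀ - x| ≤ H) (h1 : |X₁ - x| ≤ H) (h2 : |X₂ - x| ≤ H) (h3 : |X₃ - x| ≤ H)
    (l0 : ℓ ≤ X₁ - X₀) (l1 : ℓ ≤ X₂ - X₁) (l2 : ℓ ≤ X₃ - X₂) :
    |((f X₂ - f X₁) / (X₂ - X₁) - (f X₁ - f X₀) / (X₁ - X₀)) * (X₃ - X₁) -
      ((f X₃ - f X₂) / (X₃ - X₂) - (f X₂ - f X₁) / (X₂ - X₁)) * (X₂ - X₀)| ≤
      16 * δ * H ^ 3 / ℓ := by
  obtain ⟨A, B, hAB⟩ := hx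
  have hH0 : 0 ≤ H := (abs_nonneg _).trans h0
  have hE : ∀ X, |X - x| ≤ H → |f X - f x - A * (X - x) - B * (X - x) ^ 2| ≤ δ * H ^ 2 := by
    intro X hX
    have := hAB (X - x) (hX.trans hH)
    rw [add_sub_cancel] at this
    refine this.trans (mul_le_mul_of_nonneg_left ?_ hδ.le)
    exact sq_le_sq' (by linarith [(abs_le.1 hX).1]) (abs_le.1 hX).2
  have hslope : ∀ X Y, |X - x| ≤ H → |Y - x| ≤ H → ℓ ≤ Y - X →
      |(f Y - f X) / (Y - X) - (A + B * (X + Y - 2 * x))| ≤ 2 * δ * H ^ 2 / ℓ := by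
    intro X Y hX hY hXY
    have hpos : 0 < Y - X := by linarith
    have e : (f Y - f X) / (Y - X) - (A + B * (X + Y - 2 * x)) =
        ((f Y - f x - A * (Y - x) - B * (Y - x) ^ 2) -
          (f X - f x - A * (X - x) - B * (X - x) ^ 2)) / (Y - X) := by
      field_simp; ring
    rw [e, abs_div, abs_of_pos hpos]
    refine div_le_div₀ (by positivity) ?_ hℓ hXY
    refine (abs_sub _ _).trans ?_
    linarith [hE X hX, hE Y hY]
  have s0 := hslope X₀ X₁ h0 h1 l0
  have s1 := hslope X₁ X₂ h1 h2 l1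
  have s2 := hslope X₂ X₃ h2 h3 l2
  set S0 := (f X₁ - f X₀) / (X₁ - X₀)
  set S1 := (f X₂ - f X₁) / (X₂ - X₁)
  set S2 := (f X₃ - f X₂) / (X₃ - X₂)
  set e0 := S0 - (A + B * (X₀ + X₁ - 2 * x)) with he0
  set e1 := S1 - (A + B * (X₁ + X₂ - 2 * x)) with he1
  set e2 := S2 - (A + B * (X₂ + X₃ - 2 * x)) with he2
  have e : (S1 - S0) * (X₃ - X₁) - (S2 - S1) * (X₂ - X₀) =
      (e1 - e0) * (X₃ - X₁) - (e2 - e1) * (X₂ - X₀) := by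
    rw [he0, he1, he2]; ring
  rw [e]
  have d1 : |X₃ - X₁| ≤ 2 * H := by
    have : X₃ - X₁ = (X₃ - x) - (X₁ - x) := by ring
    rw [this]; exact (abs_sub _ _).trans (by linarith)
  have d0 : |X₂ - X₀| ≤ 2 * H := by
    have : X₂ - X₀ = (X₂ - x) - (X₀ - x) := by ring
    rw [this]; exact (abs_sub _ _).trans (by linarith)
  have t1 : |e1 - e0| ≤ 4 * δ * H ^ 2 / ℓ := by
    refine (abs_sub _ _).trans ((add_le_add s1 s0).trans (le_of_eq (by ring)))
  have t2 : |e2 - e1| ≤ 4 * δ * H ^ 2 / ℓ := by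
    refine (abs_sub _ _).trans ((add_le_add s2 s1).trans (le_of_eq (by ring)))
  refine (abs_sub _ _).trans ?_
  rw [abs_mul, abs_mul]
  have u1 := mul_le_mul t1 d1 (abs_nonneg _) (by positivity)
  have u2 := mul_le_mul t2 d0 (abs_nonneg _) (by positivity)
  refine (add_le_add u1 u2).trans (le_of_eq (by ring))

/-- The algebraic consequence of the previous estimate for three consecutive edges `(aⱼ, bⱼ)`: the
ratio `a₁ / a₀` almost solves a quadratic equation whose coefficients depend only on the determinants
of the edges. -/
lemma quadratic_estimate {a₀ a₁ a₂ b₀ b₁ b₂ c₀ M D K : ℝ} (hc : 0 < c₀) (ha0 : c₀ ≤ a₀)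
    (ha0' : a₀ ≤ M) (ha1 : 0 < a₁) (ha1' : a₁ ≤ M) (ha2 : 0 < a₂) (ha2' : a₂ ≤ M)
    (hD0 : 0 ≤ a₀ * b₁ - b₀ * a₁) (hD : a₀ * b₁ - b₀ * a₁ ≤ D) (hK : 0 ≤ K)
    (h : |(b₁ / a₁ - b₀ / a₀) * (a₁ + a₂) - (b₂ / a₂ - b₁ / a₁) * (a₀ + a₁)| ≤ K) :
    |((a₀ * b₂ - b₀ * a₂) * ((a₀ * b₁ - b₀ * a₁) + (a₀ * b₂ - b₀ * a₂))) * (a₁ / a₀) ^ 2 +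
      (-((a₁ * b₂ - b₁ * a₂) * (2 * (a₀ * b₂ - b₀ * a₂) + 2 * (a₀ * b₁ - b₀ * a₁)))) * (a₁ / a₀) +
      ((a₁ * b₂ - b₁ * a₂) ^ 2 - (a₀ * b₁ - b₀ * a₁) * (a₁ * b₂ - b₁ * a₂))| ≤
      D * M ^ 3 * K / c₀ ^ 2 := by
  have hp0 : 0 < a₀ := by linarith
  have hM : 0 < M := by linarith
  have e : ((a₀ * b₂ - b₀ * a₂) * ((a₀ * b₁ - b₀ * a₁) + (a₀ * b₂ - b₀ * a₂))) * (a₁ / a₀) ^ 2 +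
      (-((a₁ * b₂ - b₁ * a₂) * (2 * (a₀ * b₂ - b₀ * a₂) + 2 * (a₀ * b₁ - b₀ * a₁)))) * (a₁ / a₀) +
      ((a₁ * b₂ - b₁ * a₂) ^ 2 - (a₀ * b₁ - b₀ * a₁) * (a₁ * b₂ - b₁ * a₂)) =
      (a₀ * b₁ - b₀ * a₁) * (a₀ * a₁ * a₂) *
        ((b₁ / a₁ - b₀ / a₀) * (a₁ + a₂) - (b₂ / a₂ - b₁ / a₁) * (a₀ + a₁)) / a₀ ^ 2 := by
    field_simp
    ring
  rw [e, abs_div, abs_mul, abs_of_pos (by positivity : 0 < a₀ ^ 2)]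
  refine div_le_div₀ (by have := hD0.trans hD; positivity) ?_ (by positivity)
    (pow_le_pow_left₀ hc.le ha0 2)
  refine mul_le_mul ?_ h (abs_nonneg _) (by have := hD0.trans hD; positivity)
  rw [abs_mul, abs_of_nonneg hD0, abs_of_pos (by positivity : 0 < a₀ * a₁ * a₂)]
  refine mul_le_mul hD ?_ (by positivity) (hD0.trans hD)
  calc a₀ * a₁ * a₂ ≤ M * M * M := by gcongr
    _ = M ^ 3 := by ring

/-! ### Convex lattice chains on the graph of a convex function -/

/-- The first `k` points `(x j, y j)` of a sequence of lattice points are the vertices, from left to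
right, of a strictly convex polygonal chain whose edges have slopes in `[-1, 1]`. -/
structure IsConvexLatticeChain (k : ℕ) (x y : ℕ → ℤ) : Prop where
  lt : ∀ j, j + 1 < k → x j < x (j + 1)
  lip : ∀ j, j + 1 < k → |y (j + 1) - y j| ≤ x (j + 1) - x j
  strict : ∀ j, j + 2 < k →
    (y (j + 1) - y j) * (x (j + 2) - x (j + 1)) < (y (j + 2) - y (j + 1)) * (x (j + 1) - x j)

/-- The slope of the `j`-th edge of a chain. -/
noncomputable def chainSlope (x y : ℕ → ℤ) (j : ℕ) : ℝ :=
  ((y (j + 1) - y j : ℤ) : ℝ) / ((x (j + 1) - x j : ℤ) : ℝ)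

namespace IsConvexLatticeChain

variable {k : ℕ} {x y : ℕ → ℤ}

lemma width_pos (h : IsConvexLatticeChain k x y) {j : ℕ} (hj : j + 1 < k) :
    (0 : ℝ) < ((x (j + 1) - x j : ℤ) : ℝ) := by
  have := h.lt j hj
  exact_mod_cast sub_pos.2 this

lemma le_of_le (h : IsConvexLatticeChain k x y) {i j : ℕ} (hij : i ≤ j) (hj : j < k) :
    x i ≤ x j := by
  induction j, hij using Nat.le_induction with
  | base => exact le_rfl
  | succ j _ ih => exact (ih (by omega)).trans (h.lt j hj).le

lemma slope_succ_lt (h : IsConvexLatticeChain k x y) {j : ℕ} (hj : j + 2 < k) :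
    chainSlope x y j < chainSlope x y (j + 1) := by
  unfold chainSlope
  rw [div_lt_div_iff₀ (h.width_pos (by omega)) (h.width_pos (by omega))]
  exact_mod_cast h.strict j hj

lemma slope_lt (h : IsConvexLatticeChain k x y) {i j : ℕ} (hij : i < j) (hj : j + 1 < k) :
    chainSlope x y i < chainSlope x y j := by
  induction j, hij using Nat.le_induction with
  | base => exact h.slope_succ_lt hj
  | succ j _ ih => exact (ih (by omega)).trans (h.slope_succ_lt hj)

lemma abs_slope_le (h : IsConvexLatticeChain k x y) {j : ℕ} (hj : j + 1 < k) :
    |chainSlope x y j| ≤ 1 := by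
  unfold chainSlope
  rw [abs_div, abs_of_pos (h.width_pos hj), div_le_one (h.width_pos hj)]
  exact_mod_cast h.lip j hj

lemma edge_injective (h : IsConvexLatticeChain k x y) {i j : ℕ} (hi : i + 1 < k) (hj : j + 1 < k)
    (h1 : x (i + 1) - x i = x (j + 1) - x j) (h2 : y (i + 1) - y i = y (j + 1) - y j) : i = j := by
  have e : chainSlope x y i = chainSlope x y j := by
    unfold chainSlope; rw [h1, h2]
  rcases lt_trichotomy i j with hij | hij | hij
  · exact absurd e (h.slope_lt hij hj).ne
  · exact hij
  · exact absurd e (h.slope_lt hij hi).ne'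

lemma card_short_le (h : IsConvexLatticeChain k x y) {M : ℝ} (hM : 0 ≤ M) (s : Finset ℕ)
    (hs : ∀ j ∈ s, j + 1 < k ∧ ((x (j + 1) - x j : ℤ) : ℝ) ≤ M) :
    (s.card : ℝ) ≤ M * (2 * M + 1) := by
  have hcard : s.card ≤ (Finset.Icc 1 ⌊M⌋ ×ˢ Finset.Icc (-⌊M⌋) ⌊M⌋).card := by
    refine Finset.card_le_card_of_injOn
      (fun j => (x (j + 1) - x j, y (j + 1) - y j)) ?_ ?_
    · intro j hj
      obtain ⟨h1, h2⟩ := hs j hj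
      have h3 : x (j + 1) - x j ≤ ⌊M⌋ := Int.le_floor.2 h2
      have h4 := h.lt j h1
      have h5 := abs_le.1 (h.lip j h1)
      simp only [Finset.coe_product, Finset.coe_Icc, Set.mem_prod, Set.mem_Icc]
      omega
    · intro i hi j hj hij
      simp only [Prod.mk.injEq] at hij
      exact h.edge_injective (hs i hi).1 (hs j hj).1 hij.1 hij.2
  have hfl : 0 ≤ ⌊M⌋ := Int.floor_nonneg.2 hM
  have e : ((Finset.Icc 1 ⌊M⌋ ×ˢ Finset.Icc (-⌊M⌋) ⌊M⌋).card : ℤ) = ⌊M⌋ * (2 * ⌊M⌋ + 1) := by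
    rw [Finset.card_product, Int.card_Icc, Int.card_Icc]
    push_cast
    rw [Int.toNat_of_nonneg (by omega), Int.toNat_of_nonneg (by omega)]
    ring
  have e' : ((Finset.Icc 1 ⌊M⌋ ×ˢ Finset.Icc (-⌊M⌋) ⌊M⌋).card : ℝ) =
      (⌊M⌋ : ℝ) * (2 * (⌊M⌋ : ℝ) + 1) := by exact_mod_cast e
  have hflM := Int.floor_le M
  have hfl' : (0 : ℝ) ≤ (⌊M⌋ : ℝ) := by exact_mod_cast hfl
  calc (s.card : ℝ) ≤ (⌊M⌋ : ℝ) * (2 * (⌊M⌋ : ℝ) + 1) := by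
        rw [← e']; exact_mod_cast hcard
    _ ≤ M * (2 * M + 1) := by gcongr

lemma card_long_mul_le (h : IsConvexLatticeChain k x y) {M X : ℝ} (hX0 : 0 ≤ X)
    (hX : ∀ j < k, |(x j : ℝ)| ≤ X) (s : Finset ℕ)
    (hs : ∀ j ∈ s, j + 1 < k ∧ M ≤ ((x (j + 1) - x j : ℤ) : ℝ)) :
    (s.card : ℝ) * M ≤ 2 * X := by
  rcases Nat.eq_zero_or_pos k with hk | hk
  · have : s = ∅ := Finset.eq_empty_of_forall_notMem fun j hj => by
      have := (hs j hj).1; omega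
    rw [this]; simpa using hX0
  calc (s.card : ℝ) * M ≤ ∑ j ∈ s, ((x (j + 1) - x j : ℤ) : ℝ) := by
        rw [← nsmul_eq_mul]
        exact Finset.card_nsmul_le_sum _ _ _ fun j hj => (hs j hj).2
    _ ≤ ∑ j ∈ Finset.range (k - 1), ((x (j + 1) - x j : ℤ) : ℝ) := by
        refine Finset.sum_le_sum_of_subset_of_nonneg ?_ ?_
        · intro j hj
          have := (hs j hj).1
          rw [Finset.mem_range]; omega
        · intro j hj _
          rw [Finset.mem_range] at hj
          exact (h.width_pos (by omega)).le
    _ = (x (k - 1) : ℝ) - x 0 := by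
        push_cast
        exact Finset.sum_range_sub (fun j => (x j : ℝ)) (k - 1)
    _ ≤ 2 * X := by
        have h1 := (abs_le.1 (hX (k - 1) (by omega))).2
        have h2 := (abs_le.1 (hX 0 hk)).1
        linarith

lemma card_steep_mul_le (h : IsConvexLatticeChain k x y) {θ : ℝ} (s : Finset ℕ)
    (hs : ∀ j ∈ s, j + 3 < k ∧ θ ≤ chainSlope x y (j + 2) - chainSlope x y j) :
    (s.card : ℝ) * θ ≤ 4 := by
  rcases Nat.lt_or_ge 3 k with hk | hk
  swap
  · have : s = ∅ := Finset.eq_empty_of_forall_notMem fun j hj => by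
      have := (hs j hj).1; omega
    rw [this]; simp
  calc (s.card : ℝ) * θ ≤ ∑ j ∈ s, (chainSlope x y (j + 2) - chainSlope x y j) := by
        rw [← nsmul_eq_mul]
        exact Finset.card_nsmul_le_sum _ _ _ fun j hj => (hs j hj).2
    _ ≤ ∑ j ∈ Finset.range (k - 3), (chainSlope x y (j + 2) - chainSlope x y j) := by
        refine Finset.sum_le_sum_of_subset_of_nonneg ?_ ?_
        · intro j hj
          have := (hs j hj).1
          rw [Finset.mem_range]; omega
        · intro j hj _
          rw [Finset.mem_range] at hj
          exact sub_nonneg.2 (h.slope_lt (by omega) (by omega)).le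
    _ = (chainSlope x y (k - 3 + 1) - chainSlope x y (0 + 1)) +
          (chainSlope x y (k - 3) - chainSlope x y 0) := by
        rw [← Finset.sum_range_sub (fun j => chainSlope x y (j + 1)) (k - 3),
          ← Finset.sum_range_sub (fun j => chainSlope x y j) (k - 3), ← Finset.sum_add_distrib]
        exact Finset.sum_congr rfl fun j _ => by ring
    _ ≤ 4 := by
        have h1 := (abs_le.1 (h.abs_slope_le (j := k - 3 + 1) (by omega))).2
        have h2 := (abs_le.1 (h.abs_slope_le (j := 0 + 1) (by omega))).1
        have h3 := (abs_le.1 (h.abs_slope_le (j := k - 3) (by omega))).2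
        have h4 := (abs_le.1 (h.abs_slope_le (j := 0) (by omega))).1
        linarith

end IsConvexLatticeChain

/-- A version of `exists_card_companion_le` that is uniform over a finite set of pairs of a
determinant and a ratio. -/
lemma exists_card_companion_le_finset {C ε ε' : ℝ} (hC : 0 < C) (hε : 0 < ε) (hε' : 0 < ε')
    (L : Finset (ℤ × ℝ)) (hL : ∀ t ∈ L, 0 < t.1) :
    ∃ η > 0, ∃ N₀ : ℝ, ∀ N ≥ N₀, 0 < N → ∀ S : Finset (ℤ × ℤ),
      (∀ v ∈ S, ε * N < v.1 ∧ (v.1 : ℝ) ≤ C * N ∧ |v.2| ≤ v.1 ∧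
        ∃ t ∈ L, ∃ v' : ℤ × ℤ, v.1 * v'.2 - v.2 * v'.1 = t.1 ∧
          |(v'.1 : ℝ) - t.2 * v.1| ≤ η * N) →
      (S.card : ℝ) ≤ L.card * (ε' * N ^ 2) := by
  classical
  induction L using Finset.induction_on with
  | empty =>
    refine ⟨1, one_pos, 0, fun N _ _ S hS => ?_⟩
    have : S = ∅ := Finset.eq_empty_of_forall_notMem fun v hv => by
      obtain ⟨-, -, -, t, ht, -⟩ := hS v hv
      simp at ht
    rw [this]; simp
  | insert t L htL ih =>
    obtain ⟨η₁, hη₁, N₁, h₁⟩ := ih fun t' ht' => hL t' (Finset.mem_insert_of_mem ht')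
    obtain ⟨η₂, hη₂, N₂, h₂⟩ := exists_card_companion_le t.2 hC hε hε'
      (hL t (Finset.mem_insert_self _ _))
    refine ⟨min η₁ η₂, lt_min hη₁ hη₂, max N₁ N₂, fun N hN hNpos S hS => ?_⟩
    set P : ℤ × ℤ → Prop := fun v => ∃ v' : ℤ × ℤ, v.1 * v'.2 - v.2 * v'.1 = t.1 ∧
      |(v'.1 : ℝ) - t.2 * v.1| ≤ min η₁ η₂ * N with hP
    have c2 := h₂ N ((le_max_right _ _).trans hN) (S.filter P) (fun v hv => by
      obtain ⟨hv1, v', hv2, hv3⟩ := Finset.mem_filter.1 hv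
      obtain ⟨g1, g2, g3, -⟩ := hS v hv1
      exact ⟨g1, g2, g3, v', hv2,
        hv3.trans (mul_le_mul_of_nonneg_right (min_le_right _ _) hNpos.le)⟩)
    have c1 := h₁ N ((le_max_left _ _).trans hN) hNpos (S.filter fun v => ¬ P v) (fun v hv => by
      obtain ⟨hv1, hv2⟩ := Finset.mem_filter.1 hv
      obtain ⟨g1, g2, g3, t', ht', v', g4, g5⟩ := hS v hv1
      refine ⟨g1, g2, g3, t', ?_, v', g4,
        g5.trans (mul_le_mul_of_nonneg_right (min_le_left _ _) hNpos.le)⟩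
      rcases Finset.mem_insert.1 ht' with rfl | h
      · exact absurd ⟨v', g4, g5⟩ hv2
      · exact h)
    rw [Finset.card_insert_of_notMem htL, ← Finset.card_filter_add_card_filter_not P]
    push_cast
    linarith

/-- The roots of the quadratic polynomials of `quadratic_estimate`, chosen as functions of the three
determinants `p = det (v₀, v₁)`, `q = det (v₀, v₂)` and `s = det (v₁, v₂)`. -/
lemma exists_quadratic_roots : ∃ rt : ℤ → ℤ → ℤ → Bool → ℝ, ∀ p q s : ℤ, 1 ≤ p → 1 ≤ q →
    ∀ ρ τ : ℝ, 0 ≤ τ →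
      |((q : ℝ) * (p + q)) * ρ ^ 2 + (-((s : ℝ) * (2 * q + 2 * p))) * ρ +
        ((s : ℝ) ^ 2 - p * s)| ≤ τ ^ 2 → ∃ b, |ρ - rt p q s b| ≤ τ := by
  have : ∀ p q s : ℤ, ∃ r : Bool → ℝ, 1 ≤ p → 1 ≤ q → ∀ ρ τ : ℝ, 0 ≤ τ →
      |((q : ℝ) * (p + q)) * ρ ^ 2 + (-((s : ℝ) * (2 * q + 2 * p))) * ρ +
        ((s : ℝ) ^ 2 - p * s)| ≤ τ ^ 2 → ∃ b, |ρ - r b| ≤ τ := by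
    intro p q s
    by_cases h : 1 ≤ p ∧ 1 ≤ q
    · have hp : (1 : ℝ) ≤ p := by exact_mod_cast h.1
      have hq : (1 : ℝ) ≤ q := by exact_mod_cast h.2
      obtain ⟨r, hr⟩ := exists_near_root (A := (q : ℝ) * (p + q)) (by nlinarith)
        (-((s : ℝ) * (2 * q + 2 * p))) ((s : ℝ) ^ 2 - p * s)
      exact ⟨r, fun _ _ => hr⟩
    · exact ⟨fun _ => 0, fun h1 h2 => absurd ⟨h1, h2⟩ h⟩
  choose rt h using this
  exact ⟨rt, h⟩

/-- Three consecutive edges of width comparable to `N` of a chain on the graph of `f`, dilated by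
`N³`, over a point where `f` has a good second order expansion: the determinants of the edges are
bounded, and the ratio of the widths of the first two is close to a root of a quadratic polynomial
determined by them. -/
lemma exists_near_root_of_mem {f : ℝ → ℝ} {rt : ℤ → ℤ → ℤ → Bool → ℝ}
    (hrt : ∀ p q s : ℤ, 1 ≤ p → 1 ≤ q → ∀ ρ τ : ℝ, 0 ≤ τ →
      |((q : ℝ) * (p + q)) * ρ ^ 2 + (-((s : ℝ) * (2 * q + 2 * p))) * ρ +
        ((s : ℝ) ^ 2 - p * s)| ≤ τ ^ 2 → ∃ b, |ρ - rt p q s b| ≤ τ)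
    {ε η T N z : ℝ} {m : ℕ} {D : ℤ} (hε : 0 < ε) (hη : 0 < η) (hD0 : 0 < D)
    (hD : T / ε ^ 2 ≤ D) (hN : 0 < N) (hm : 3 / (ε * N ^ 2) ≤ 1 / ((m : ℝ) + 1))
    (hz : z ∈ quadApproxSet f ((η * ε) ^ 2 * ε ^ 9 / (432 * D)) m)
    {k : ℕ} {x y : ℕ → ℤ} (h : IsConvexLatticeChain k x y)
    (hy : ∀ j < k, (y j : ℝ) = N ^ 3 * f (x j / N ^ 3)) {i : ℕ} (hi : i + 3 < k)
    (hw : ∀ j, i ≤ j → j ≤ i + 2 → ε * N < ((x (j + 1) - x j : ℤ) : ℝ) ∧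
      ((x (j + 1) - x j : ℤ) : ℝ) ≤ N / ε)
    (hT : chainSlope x y (i + 2) - chainSlope x y i ≤ T / N ^ 2)
    (hzi : x i / N ^ 3 ≤ z) (hzi' : z ≤ x (i + 1) / N ^ 3) :
    ∃ p ∈ Finset.Icc 1 D, ∃ q ∈ Finset.Icc 1 D, ∃ s ∈ Finset.Icc 1 D, ∃ b : Bool,
      (x (i + 1) - x i) * (y (i + 2) - y (i + 1)) -
        (y (i + 1) - y i) * (x (i + 2) - x (i + 1)) = p ∧
      |((x (i + 2) - x (i + 1) : ℤ) : ℝ) - rt p q s b * ((x (i + 1) - x i : ℤ) : ℝ)| ≤ η * N := by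
  have hD0' : (0 : ℝ) < D := by exact_mod_cast hD0
  obtain ⟨w0, w0'⟩ := hw i le_rfl (by omega)
  obtain ⟨w1, w1'⟩ := hw (i + 1) (by omega) (by omega)
  obtain ⟨w2, w2'⟩ := hw (i + 2) (by omega) le_rfl
  have s01 := h.slope_succ_lt (j := i) (by omega)
  have s12 := h.slope_succ_lt (j := i + 1) (by omega)
  simp only [add_assoc, Nat.reduceAdd] at w0 w0' w1 w1' w2 w2' s01 s12
  set δ := (η * ε) ^ 2 * ε ^ 9 / (432 * D) with hδ
  have hδ0 : 0 < δ := by positivity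
  have hεN : 0 < ε * N := by positivity
  -- the determinant of two edges as a difference of slopes
  have hdet : ∀ j l : ℕ, 0 < ((x (j + 1) - x j : ℤ) : ℝ) → 0 < ((x (l + 1) - x l : ℤ) : ℝ) →
      (((x (j + 1) - x j) * (y (l + 1) - y l) - (y (j + 1) - y j) * (x (l + 1) - x l) : ℤ) : ℝ) =
      ((x (j + 1) - x j : ℤ) : ℝ) * ((x (l + 1) - x l : ℤ) : ℝ) *
        (chainSlope x y l - chainSlope x y j) := by
    intro j l hj hl
    unfold chainSlope
    generalize x (j + 1) - x j = a at hj ⊢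
    generalize x (l + 1) - x l = a' at hl ⊢
    push_cast
    field_simp
  have hdet_mem : ∀ j l : ℕ, ε * N < ((x (j + 1) - x j : ℤ) : ℝ) →
      ((x (j + 1) - x j : ℤ) : ℝ) ≤ N / ε → ε * N < ((x (l + 1) - x l : ℤ) : ℝ) →
      ((x (l + 1) - x l : ℤ) : ℝ) ≤ N / ε → chainSlope x y j < chainSlope x y l →
      chainSlope x y l - chainSlope x y j ≤ T / N ^ 2 →
      (x (j + 1) - x j) * (y (l + 1) - y l) - (y (j + 1) - y j) * (x (l + 1) - x l)
        ∈ Finset.Icc 1 D := by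
    intro j l hj hj' hl hl' hjl hjl'
    have hj0 := hεN.trans hj
    have hl0 := hεN.trans hl
    have e := hdet j l hj0 hl0
    rw [Finset.mem_Icc]
    constructor
    · have : (0 : ℝ) < (((x (j + 1) - x j) * (y (l + 1) - y l) -
          (y (j + 1) - y j) * (x (l + 1) - x l) : ℤ) : ℝ) := by
        rw [e]; exact mul_pos (mul_pos hj0 hl0) (sub_pos.2 hjl)
      exact Int.add_one_le_iff.2 (by exact_mod_cast this)
    · have : (((x (j + 1) - x j) * (y (l + 1) - y l) -
          (y (j + 1) - y j) * (x (l + 1) - x l) : ℤ) : ℝ) ≤ (D : ℝ) := by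
        rw [e]
        refine le_trans ?_ hD
        calc _ ≤ N / ε * (N / ε) * (T / N ^ 2) := by
              refine mul_le_mul (mul_le_mul hj' hl' hl0.le (by positivity)) hjl'
                (sub_pos.2 hjl).le (by positivity)
          _ = T / ε ^ 2 := by field_simp
      exact_mod_cast this
  have hp := hdet_mem i (i + 1) w0 w0' (by simpa only [add_assoc] using w1)
    (by simpa only [add_assoc] using w1') s01 (by linarith)
  have hq := hdet_mem i (i + 2) w0 w0' (by simpa only [add_assoc] using w2)
    (by simpa only [add_assoc] using w2') (s01.trans s12) hT
  have hs := hdet_mem (i + 1) (i + 2) (by simpa only [add_assoc] using w1)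
    (by simpa only [add_assoc] using w1') (by simpa only [add_assoc] using w2)
    (by simpa only [add_assoc] using w2') s12 (by linarith)
  simp only [add_assoc, Nat.reduceAdd] at hp hq hs
  set a₀ : ℤ := x (i + 1) - x i with ha₀
  set a₁ : ℤ := x (i + 2) - x (i + 1) with ha₁
  set a₂ : ℤ := x (i + 3) - x (i + 2) with ha₂
  set b₀ : ℤ := y (i + 1) - y i with hb₀
  set b₁ : ℤ := y (i + 2) - y (i + 1) with hb₁
  set b₂ : ℤ := y (i + 3) - y (i + 2) with hb₂
  have hN3 : 0 < N ^ 3 := by positivity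
  -- the slope estimate, rescaled
  have hK : |((b₁ : ℝ) / a₁ - b₀ / a₀) * (a₁ + a₂) - ((b₂ : ℝ) / a₂ - b₁ / a₁) * (a₀ + a₁)| ≤
      432 * δ / (ε ^ 4 * N) := by
    have d0 : (x (i + 1) : ℝ) / N ^ 3 - x i / N ^ 3 = a₀ / N ^ 3 := by
      rw [ha₀]; push_cast; ring
    have d1 : (x (i + 2) : ℝ) / N ^ 3 - x (i + 1) / N ^ 3 = a₁ / N ^ 3 := by
      rw [ha₁]; push_cast; ring
    have d2 : (x (i + 3) : ℝ) / N ^ 3 - x (i + 2) / N ^ 3 = a₂ / N ^ 3 := by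
      rw [ha₂]; push_cast; ring
    have hlow : ∀ a : ℤ, ε * N < a → ε / N ^ 2 ≤ a / N ^ 3 := by
      intro a ha
      rw [div_le_div_iff₀ (by positivity) hN3]
      calc ε * N ^ 3 = ε * N * N ^ 2 := by ring
        _ ≤ a * N ^ 2 := mul_le_mul_of_nonneg_right ha.le (by positivity)
    have hup : ∀ a : ℤ, (a : ℝ) ≤ N / ε → a / N ^ 3 ≤ 1 / (ε * N ^ 2) := by
      intro a ha
      rw [div_le_iff₀ hN3]
      refine ha.trans (le_of_eq ?_)
      field_simp
    have hu0 := hup a₀ w0'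
    have hu1 := hup a₁ w1'
    have hu2 := hup a₂ w2'
    have hl0 := hlow a₀ w0
    have hl1 := hlow a₁ w1
    have hl2 := hlow a₂ w2
    have hpos : 0 < ε / N ^ 2 := by positivity
    have e3 : 3 / (ε * N ^ 2) = 3 * (1 / (ε * N ^ 2)) := by ring
    have hX : ∀ j < k, f (x j / N ^ 3) = y j / N ^ 3 := by
      intro j hj
      rw [hy j hj]; field_simp
    have key := slope_estimate (X₀ := x i / N ^ 3) (X₁ := x (i + 1) / N ^ 3)
      (X₂ := x (i + 2) / N ^ 3) (X₃ := x (i + 3) / N ^ 3) hδ0 hz hm hpos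
      (abs_le.2 ⟨by rw [e3]; linarith, by rw [e3]; linarith⟩)
      (abs_le.2 ⟨by rw [e3]; linarith, by rw [e3]; linarith⟩)
      (abs_le.2 ⟨by rw [e3]; linarith, by rw [e3]; linarith⟩)
      (abs_le.2 ⟨by rw [e3]; linarith, by rw [e3]; linarith⟩)
      (d0 ▸ hl0) (d1 ▸ hl1) (d2 ▸ hl2)
    rw [hX i (by omega), hX (i + 1) (by omega), hX (i + 2) (by omega), hX (i + 3) (by omega),
      d0, d1, d2] at key
    have f0 : ((y (i + 1) : ℝ) / N ^ 3 - y i / N ^ 3) / (a₀ / N ^ 3) = b₀ / a₀ := by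
      rw [hb₀]; push_cast; field_simp
    have f1 : ((y (i + 2) : ℝ) / N ^ 3 - y (i + 1) / N ^ 3) / (a₁ / N ^ 3) = b₁ / a₁ := by
      rw [hb₁]; push_cast; field_simp
    have f2 : ((y (i + 3) : ℝ) / N ^ 3 - y (i + 2) / N ^ 3) / (a₂ / N ^ 3) = b₂ / a₂ := by
      rw [hb₂]; push_cast; field_simp
    have g1 : (x (i + 3) : ℝ) / N ^ 3 - x (i + 1) / N ^ 3 = (a₁ + a₂) / N ^ 3 := by
      rw [ha₁, ha₂]; push_cast; ring
    have g0 : (x (i + 2) : ℝ) / N ^ 3 - x i / N ^ 3 = (a₀ + a₁) / N ^ 3 := by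
      rw [ha₀, ha₁]; push_cast; ring
    rw [f0, f1, f2, g0, g1] at key
    have e : ((b₁ : ℝ) / a₁ - b₀ / a₀) * (a₁ + a₂) - ((b₂ : ℝ) / a₂ - b₁ / a₁) * (a₀ + a₁) =
        N ^ 3 * (((b₁ : ℝ) / a₁ - b₀ / a₀) * ((a₁ + a₂) / N ^ 3) -
          ((b₂ : ℝ) / a₂ - b₁ / a₁) * ((a₀ + a₁) / N ^ 3)) := by
      have : ∀ u v : ℝ, u * v = N ^ 3 * (u * (v / N ^ 3)) := by
        intro u v; field_simp
      rw [mul_sub, ← this, ← this]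
    rw [e, abs_mul, abs_of_pos hN3]
    refine (mul_le_mul_of_nonneg_left key hN3.le).trans (le_of_eq ?_)
    field_simp
    norm_num
  obtain ⟨hp1, hp2⟩ := Finset.mem_Icc.1 hp
  obtain ⟨hq1, hq2⟩ := Finset.mem_Icc.1 hq
  have hpr : (0 : ℝ) ≤ (a₀ : ℝ) * b₁ - b₀ * a₁ := by
    have : (0 : ℤ) ≤ a₀ * b₁ - b₀ * a₁ := by omega
    exact_mod_cast this
  have hpr' : (a₀ : ℝ) * b₁ - b₀ * a₁ ≤ D := by exact_mod_cast hp2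
  have hquad := quadratic_estimate (c₀ := ε * N) (M := N / ε) (D := D) hεN w0.le w0'
    (hεN.trans w1) w1' (hεN.trans w2) w2' hpr hpr' (by positivity) hK
  have hval : (D : ℝ) * (N / ε) ^ 3 * (432 * δ / (ε ^ 4 * N)) / (ε * N) ^ 2 = (η * ε) ^ 2 := by
    rw [hδ]; field_simp
  rw [hval] at hquad
  obtain ⟨b, hb⟩ := hrt (a₀ * b₁ - b₀ * a₁) (a₀ * b₂ - b₀ * a₂) (a₁ * b₂ - b₁ * a₂) hp1 hq1
    ((a₁ : ℝ) / a₀) (η * ε) (by positivity) (by push_cast; exact hquad)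
  refine ⟨_, hp, _, hq, _, hs, b, rfl, ?_⟩
  have ha0pos : (0 : ℝ) < a₀ := hεN.trans w0
  have e : (a₁ : ℝ) - rt (a₀ * b₁ - b₀ * a₁) (a₀ * b₂ - b₀ * a₂) (a₁ * b₂ - b₁ * a₂) b * a₀ =
      ((a₁ : ℝ) / a₀ - rt (a₀ * b₁ - b₀ * a₁) (a₀ * b₂ - b₀ * a₂) (a₁ * b₂ - b₁ * a₂) b) * a₀ := by
    field_simp
  rw [e, abs_mul, abs_of_pos ha0pos]
  calc _ ≤ η * ε * (N / ε) := mul_le_mul hb w0' ha0pos.le (by positivity)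
    _ = η * N := by field_simp

/-- A strictly convex lattice chain with slopes in `[-1, 1]` whose vertices lie on the graph of a
convex function dilated by `n = N³` has `o(n^{2/3})` vertices. -/
lemma exists_chain_card_le {f : ℝ → ℝ} (hf : ConvexOn ℝ Set.univ f) (hfc : Continuous f)
    {R c : ℝ} (hR : 0 < R) (hc : 0 < c) :
    ∃ N₀ : ℝ, ∀ N ≥ N₀, ∀ (k : ℕ) (x y : ℕ → ℤ), IsConvexLatticeChain k x y →
      (∀ j < k, |(x j : ℝ)| ≤ R * N ^ 3) → (∀ j < k, (y j : ℝ) = N ^ 3 * f (x j / N ^ 3)) →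
      (k : ℝ) ≤ c * N ^ 2 := by
  classical
  -- edges are usable if their width lies in `[ε N, N / ε]`
  obtain ⟨ε, hε, hεc⟩ : ∃ ε : ℝ, 0 < ε ∧ 9 * ε ^ 2 + 6 * R * ε ≤ c / 4 := by
    refine ⟨min 1 (c / (4 * (9 + 6 * R))), lt_min one_pos (by positivity), ?_⟩
    set ε := min 1 (c / (4 * (9 + 6 * R))) with hε
    have h0 : 0 < ε := lt_min one_pos (by positivity)
    have h1 : ε ≤ 1 := min_le_left _ _
    have h2 : ε * (4 * (9 + 6 * R)) ≤ c := by
      rw [← le_div_iff₀ (by positivity)]; exact min_le_right _ _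
    nlinarith
  set T : ℝ := 16 / c with hT
  have hT0 : 0 < T := by positivity
  obtain ⟨D, hD⟩ : ∃ D : ℤ, max 0 (T / ε ^ 2) < D := exists_int_gt _
  have hD0 : 0 < D := by
    have := (le_max_left _ _).trans_lt hD
    exact_mod_cast this
  have hD0' : (0 : ℝ) < D := by exact_mod_cast hD0
  have hDT : T / ε ^ 2 ≤ D := (le_max_right _ _).trans hD.le
  obtain ⟨rt, hrt⟩ := exists_quadratic_roots
  -- the finitely many pairs of a determinant and a limiting ratio
  set L : Finset (ℤ × ℝ) :=
    (Finset.Icc 1 D ×ˢ Finset.Icc 1 D ×ˢ Finset.Icc 1 D ×ˢ (Finset.univ : Finset Bool)).image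
      fun t => (t.1, rt t.1 t.2.1 t.2.2.1 t.2.2.2) with hL
  have hLpos : ∀ t ∈ L, 0 < t.1 := by
    intro t ht
    obtain ⟨t', ht', rfl⟩ := Finset.mem_image.1 ht
    have := (Finset.mem_Icc.1 (Finset.mem_product.1 ht').1).1
    simp only
    omega
  set ε' : ℝ := c / (8 * (L.card + 1)) with hε'
  have hε'0 : 0 < ε' := by positivity
  obtain ⟨η, hη, N₁, hcount⟩ := exists_card_companion_le_finset (C := 1 / ε) (by positivity) hε
    hε'0 L hLpos
  -- for this `δ` the error in the quadratic equation is `(η ε)²`, so the ratio is within `η ε` of a root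
  set δ := (η * ε) ^ 2 * ε ^ 9 / (432 * D) with hδ
  have hδ0 : 0 < δ := by positivity
  set μ := c * ε / 8 with hμ
  obtain ⟨m, hm⟩ := exists_sum_length_le hf hfc R hδ0 (μ := μ) (by positivity)
  refine ⟨max (max 1 N₁) (max (1 / ε) (max (12 / c) (3 * (m + 1) / ε))), ?_⟩
  intro N hN k x y h hx hy
  simp only [ge_iff_le, max_le_iff] at hN
  obtain ⟨⟨hN1, hN2⟩, hN3, hN4, hN5⟩ := hN
  have hN0 : 0 < N := by linarith
  have hNsq : N ≤ N ^ 2 := by nlinarith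
  have hN30 : 0 < N ^ 3 := by positivity
  have hεN1 : 1 ≤ ε * N := by
    rw [div_le_iff₀ hε] at hN3; linarith
  have hN4' : 3 ≤ c / 4 * N ^ 2 := by
    rw [div_le_iff₀ hc] at hN4
    nlinarith
  have hmN : 3 / (ε * N ^ 2) ≤ 1 / ((m : ℝ) + 1) := by
    rw [div_le_iff₀ hε] at hN5
    rw [div_le_div_iff₀ (by positivity) (by positivity)]
    nlinarith
  -- the width of an edge
  set a : ℕ → ℝ := fun j => ((x (j + 1) - x j : ℤ) : ℝ) with ha
  -- `B₁`, `B₂`, `B₃`, `B₄` collect the short edges, the long edges, the edges with a large increment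
  -- of slope, and the edges that miss the points with a good expansion; `G` collects the other ones
  set B₁ := (Finset.range (k - 1)).filter fun j => a j ≤ ε * N with hB₁
  set B₂ := (Finset.range (k - 1)).filter fun j => N / ε ≤ a j with hB₂
  set B₃ := (Finset.range (k - 3)).filter fun j =>
    T / N ^ 2 ≤ chainSlope x y (j + 2) - chainSlope x y j with hB₃
  set B₄ := (Finset.range (k - 3)).filter fun j => ε * N < a j ∧
    Disjoint (Set.Ico ((x j : ℝ) / N ^ 3) (x (j + 1) / N ^ 3)) (quadApproxSet f δ m) with hB₄
  set G := (Finset.range (k - 3)).filter fun j =>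
    (∀ l, j ≤ l → l ≤ j + 2 → ε * N < a l ∧ a l ≤ N / ε) ∧
    chainSlope x y (j + 2) - chainSlope x y j ≤ T / N ^ 2 ∧
    ¬ Disjoint (Set.Ico ((x j : ℝ) / N ^ 3) (x (j + 1) / N ^ 3)) (quadApproxSet f δ m) with hG
  have c₁ : (B₁.card : ℝ) ≤ 3 * ε ^ 2 * N ^ 2 := by
    have := h.card_short_le (M := ε * N) (by positivity) B₁ fun j hj => by
      obtain ⟨h1, h2⟩ := Finset.mem_filter.1 hj
      rw [Finset.mem_range] at h1
      exact ⟨by omega, h2⟩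
    nlinarith
  have c₂ : (B₂.card : ℝ) ≤ 2 * R * ε * N ^ 2 := by
    have := h.card_long_mul_le (M := N / ε) (by positivity) hx B₂ fun j hj => by
      obtain ⟨h1, h2⟩ := Finset.mem_filter.1 hj
      rw [Finset.mem_range] at h1
      exact ⟨by omega, h2⟩
    rw [← le_div_iff₀ (by positivity)] at this
    refine this.trans (le_of_eq ?_)
    field_simp
  have c₃ : (B₃.card : ℝ) ≤ c / 4 * N ^ 2 := by
    have := h.card_steep_mul_le (θ := T / N ^ 2) B₃ fun j hj => by
      obtain ⟨h1, h2⟩ := Finset.mem_filter.1 hj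
      rw [Finset.mem_range] at h1
      exact ⟨by omega, h2⟩
    rw [← le_div_iff₀ (by positivity)] at this
    refine this.trans (le_of_eq ?_)
    rw [hT]
    field_simp
    norm_num
  have c₄ : (B₄.card : ℝ) ≤ c / 8 * N ^ 2 := by
    have key := hm B₄ (fun j => x j / N ^ 3) (fun j => x (j + 1) / N ^ 3) ?_ ?_ ?_ ?_
    · have hle : (B₄.card : ℝ) * (ε * N / N ^ 3) ≤ μ := by
        refine le_trans ?_ key
        rw [← nsmul_eq_mul]
        refine Finset.card_nsmul_le_sum _ _ _ fun j hj => ?_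
        have h2 := (Finset.mem_filter.1 hj).2.1
        rw [← sub_div]
        refine div_le_div_of_nonneg_right ?_ hN30.le
        simp only [ha] at h2
        push_cast at h2
        exact h2.le
      rw [← le_div_iff₀ (by positivity)] at hle
      refine hle.trans (le_of_eq ?_)
      rw [hμ]
      field_simp
    · intro j hj
      have h1 := Finset.mem_range.1 (Finset.mem_filter.1 hj).1
      refine div_le_div_of_nonneg_right ?_ hN30.le
      exact_mod_cast (h.lt j (by omega)).le
    · have hlt : ∀ i j, i < j → j < k → (x (i + 1) : ℝ) / N ^ 3 ≤ x j / N ^ 3 := by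
        intro i j hij hj
        refine div_le_div_of_nonneg_right ?_ hN30.le
        exact_mod_cast h.le_of_le hij hj
      intro i hi j hj hij
      have h1 := Finset.mem_range.1 (Finset.mem_filter.1 hi).1
      have h2 := Finset.mem_range.1 (Finset.mem_filter.1 hj).1
      rw [Function.onFun, Set.disjoint_left]
      rintro z ⟨z1, z2⟩ ⟨z3, z4⟩
      rcases lt_or_gt_of_ne hij with hlt' | hlt'
      · have := hlt i j hlt' (by omega)
        linarith
      · have := hlt j i hlt' (by omega)
        linarith
    · intro j hj z hz
      have h1 := Finset.mem_range.1 (Finset.mem_filter.1 hj).1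
      have h2 := (abs_le.1 (hx j (by omega))).1
      have h3 := (abs_le.1 (hx (j + 1) (by omega))).2
      constructor
      · refine le_trans ?_ hz.1
        rw [le_div_iff₀ hN30]; linarith
      · refine hz.2.le.trans ?_
        rw [div_le_iff₀ hN30]; linarith
    · intro j hj
      exact (Finset.mem_filter.1 hj).2.2
  have c₅ : (G.card : ℝ) ≤ c / 8 * N ^ 2 := by
    set V : Finset (ℤ × ℤ) := G.image fun j => (x (j + 1) - x j, y (j + 1) - y j) with hV
    have hVcard : V.card = G.card := by
      refine Finset.card_image_of_injOn fun i hi j hj hij => ?_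
      have h1 := Finset.mem_range.1 (Finset.mem_filter.1 hi).1
      have h2 := Finset.mem_range.1 (Finset.mem_filter.1 hj).1
      simp only [Prod.mk.injEq] at hij
      exact h.edge_injective (by omega) (by omega) hij.1 hij.2
    have := hcount N hN2 hN0 V fun v hv => by
      obtain ⟨i, hi, rfl⟩ := Finset.mem_image.1 hv
      obtain ⟨h1, h2, h3, h4⟩ := Finset.mem_filter.1 hi
      rw [Finset.mem_range] at h1
      obtain ⟨z, ⟨hz1, hz2⟩, hz⟩ := Set.not_disjoint_iff.1 h4
      obtain ⟨p, hp, q, hq, s, hs, b, hdet, hratio⟩ := exists_near_root_of_mem hrt hε hη hD0 hDT hN0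
        hmN hz h hy (by omega) h2 h3 hz1 hz2.le
      have hw := h2 i le_rfl (by omega)
      refine ⟨hw.1, hw.2.trans (le_of_eq (by ring)), h.lip i (by omega),
        (p, rt p q s b), ?_, (x (i + 2) - x (i + 1), y (i + 2) - y (i + 1)), hdet, hratio⟩
      refine Finset.mem_image.2 ⟨(p, q, s, b), ?_, rfl⟩
      simp only [Finset.mem_product, Finset.mem_univ, and_true]
      exact ⟨hp, hq, hs⟩
    rw [hVcard] at this
    refine this.trans ?_
    rw [← mul_assoc]
    refine mul_le_mul_of_nonneg_right ?_ (by positivity)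
    rw [hε', mul_div_assoc', div_le_div_iff₀ (by positivity) (by norm_num)]
    nlinarith
  have hcover : Finset.range (k - 3) ⊆ ((B₁ ∪ B₂) ∪ (B₁ ∪ B₂).image (fun j => j - 1)) ∪
      (B₁ ∪ B₂).image (fun j => j - 2) ∪ (B₃ ∪ B₄ ∪ G) := by
    intro i hi
    have hik := Finset.mem_range.1 hi
    by_contra hcon
    simp only [Finset.mem_union, not_or] at hcon
    obtain ⟨⟨⟨hb0, hb1⟩, hb2⟩, ⟨hb3, hb4⟩, hb5⟩ := hcon
    have hB : ∀ l, l + 1 < k → ¬ (l ∈ B₁ ∪ B₂) → ε * N < a l ∧ a l ≤ N / ε := by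
      intro l hl hnot
      rw [Finset.mem_union, not_or, Finset.mem_filter, Finset.mem_filter, Finset.mem_range] at hnot
      have hl' : l < k - 1 := by omega
      simp only [hl', true_and, not_le] at hnot
      exact ⟨hnot.1, hnot.2.le⟩
    have hall : ∀ l, i ≤ l → l ≤ i + 2 → ε * N < a l ∧ a l ≤ N / ε := by
      intro l hl1 hl2
      refine hB l (by omega) fun hmem => ?_
      obtain rfl | rfl | rfl : l = i ∨ l = i + 1 ∨ l = i + 2 := by omega
      · rw [Finset.mem_union] at hmem
        exact hmem.elim hb0.1 hb0.2
      · exact hb1 (Finset.mem_image.2 ⟨i + 1, hmem, by omega⟩)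
      · exact hb2 (Finset.mem_image.2 ⟨i + 2, hmem, by omega⟩)
    refine hb5 (Finset.mem_filter.2 ⟨hi, hall, ?_, ?_⟩)
    · by_contra! hs
      exact hb3 (Finset.mem_filter.2 ⟨hi, hs.le⟩)
    · intro hd
      exact hb4 (Finset.mem_filter.2 ⟨hi, (hall i le_rfl (by omega)).1, hd⟩)
  have hcard : k - 3 ≤ 3 * (B₁.card + B₂.card) + (B₃.card + B₄.card + G.card) := by
    have h0 := Finset.card_le_card hcover
    rw [Finset.card_range] at h0
    have hu : (B₁ ∪ B₂).card ≤ B₁.card + B₂.card := Finset.card_union_le _ _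
    have hu1 := Finset.card_image_le (s := B₁ ∪ B₂) (f := fun j => j - 1)
    have hu2 := Finset.card_image_le (s := B₁ ∪ B₂) (f := fun j => j - 2)
    have t1 := Finset.card_union_le ((B₁ ∪ B₂) ∪ (B₁ ∪ B₂).image (fun j => j - 1) ∪
      (B₁ ∪ B₂).image (fun j => j - 2)) (B₃ ∪ B₄ ∪ G)
    have t2 := Finset.card_union_le ((B₁ ∪ B₂) ∪ (B₁ ∪ B₂).image (fun j => j - 1))
      ((B₁ ∪ B₂).image (fun j => j - 2))
    have t3 := Finset.card_union_le (B₁ ∪ B₂) ((B₁ ∪ B₂).image (fun j => j - 1))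
    have t4 := Finset.card_union_le (B₃ ∪ B₄) G
    have t5 := Finset.card_union_le B₃ B₄
    omega
  have hk : (k : ℝ) ≤ 3 + (3 * (B₁.card + B₂.card) + (B₃.card + B₄.card + G.card)) := by
    have : k ≤ 3 + (3 * (B₁.card + B₂.card) + (B₃.card + B₄.card + G.card)) := by omega
    exact_mod_cast this
  have hfin : 3 * (3 * ε ^ 2 * N ^ 2 + 2 * R * ε * N ^ 2) ≤ c / 4 * N ^ 2 := by
    have := mul_le_mul_of_nonneg_right hεc (by positivity : 0 ≤ N ^ 2)
    linarith
  linarith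

/-! ### From supporting lines to convex functions -/

/-- A set with supporting lines from below of slope in `[-1, 1]` lies on the graph of a convex
function, the supremum of these lines. -/
lemma exists_convexOn_of_support {S : Set (ℝ × ℝ)} (hne : S.Nonempty)
    (hsup : ∀ p ∈ S, ∃ m : ℝ, |m| ≤ 1 ∧ ∀ q ∈ S, p.2 + m * (q.1 - p.1) ≤ q.2) :
    ∃ f : ℝ → ℝ, ConvexOn ℝ Set.univ f ∧ ∀ p ∈ S, f p.1 = p.2 := by
  obtain ⟨q₀, hq₀⟩ := hne
  have : Nonempty S := ⟨⟨q₀, hq₀⟩⟩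
  choose! m hm1 hm using hsup
  set g : S → ℝ → ℝ := fun p t => p.1.2 + m p.1 * (t - p.1.1) with hg
  have hbdd : ∀ t, BddAbove (Set.range fun p => g p t) := by
    intro t
    refine ⟨q₀.2 + |t - q₀.1|, ?_⟩
    rintro _ ⟨⟨p, hp⟩, rfl⟩
    have h1 := hm p hp q₀ hq₀
    have h2 : m p * (t - q₀.1) ≤ 1 * |t - q₀.1| := by
      refine (le_abs_self _).trans ?_
      rw [abs_mul]
      exact mul_le_mul_of_nonneg_right (hm1 p hp) (abs_nonneg _)
    simp only [hg]
    linarith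
  refine ⟨fun t => ⨆ p, g p t, ⟨convex_univ, ?_⟩, ?_⟩
  · intro s _ t _ α β hα hβ hαβ
    refine ciSup_le fun p => ?_
    have h1 : g p s ≤ ⨆ p, g p s := le_ciSup (hbdd s) p
    have h2 : g p t ≤ ⨆ p, g p t := le_ciSup (hbdd t) p
    have e : g p (α • s + β • t) = α * g p s + β * g p t := by
      simp only [hg, smul_eq_mul]
      linear_combination (m p.1 * p.1.1 - p.1.2) * hαβ
    rw [e]
    exact add_le_add (mul_le_mul_of_nonneg_left h1 hα) (mul_le_mul_of_nonneg_left h2 hβ)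
  · intro q hq
    refine le_antisymm (ciSup_le fun p => hm p.1 p.2 q hq) ?_
    have : g ⟨q, hq⟩ q.1 ≤ ⨆ p, g p q.1 := le_ciSup (hbdd q.1) ⟨q, hq⟩
    simpa [hg] using this

/-- The lattice points in a set with supporting lines from below of slope in `[-1, 1]` and without
collinear triples, ordered by abscissa, form a convex lattice chain. -/
lemma exists_card_le_of_support {S : Set (ℝ × ℝ)} {R c : ℝ} (hR : 0 < R) (hc : 0 < c)
    (hSR : ∀ p ∈ S, |p.1| ≤ R)
    (hsup : ∀ p ∈ S, ∃ m : ℝ, |m| ≤ 1 ∧ ∀ q ∈ S, p.2 + m * (q.1 - p.1) ≤ q.2)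
    (hcol : ∀ p ∈ S, ∀ q ∈ S, ∀ r ∈ S, p ≠ q → q ≠ r → p ≠ r →
      (q.1 - p.1) * (r.2 - p.2) - (q.2 - p.2) * (r.1 - p.1) ≠ 0) :
    ∃ N₀ : ℝ, ∀ N ≥ N₀, 0 < N → ∀ F : Finset (ℤ × ℤ),
      (∀ v ∈ F, ((v.1 / N ^ 3, v.2 / N ^ 3) : ℝ × ℝ) ∈ S) → (F.card : ℝ) ≤ c * N ^ 2 := by
  classical
  rcases S.eq_empty_or_nonempty with rfl | hne
  · refine ⟨0, fun N _ _ F hF => ?_⟩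
    have : F = ∅ := Finset.eq_empty_of_forall_notMem fun v hv => hF v hv
    rw [this, Finset.card_empty, Nat.cast_zero]
    positivity
  obtain ⟨f, hf, hfS⟩ := exists_convexOn_of_support hne hsup
  have hfc : Continuous f := continuousOn_univ.1 (hf.continuousOn isOpen_univ)
  obtain ⟨N₀, hN₀⟩ := exists_chain_card_le hf hfc hR hc
  refine ⟨N₀, fun N hN hNpos F hF => ?_⟩
  have hN3 : 0 < N ^ 3 := by positivity
  have hlip : ∀ p ∈ S, ∀ q ∈ S, |q.2 - p.2| ≤ |q.1 - p.1| := by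
    intro p hp q hq
    obtain ⟨m, hm, hmq⟩ := hsup p hp
    obtain ⟨m', hm', hmp⟩ := hsup q hq
    have h1 := hmq q hq
    have h2 := hmp p hp
    have t1 := (abs_le.1 ((abs_mul m (q.1 - p.1)).le.trans
      (mul_le_of_le_one_left (abs_nonneg _) hm))).1
    have t2 := (abs_le.1 ((abs_mul m' (q.1 - p.1)).le.trans
      (mul_le_of_le_one_left (abs_nonneg _) hm'))).2
    exact abs_le.2 ⟨by linarith, by linarith⟩
  have hlipF : ∀ v ∈ F, ∀ w ∈ F, |w.2 - v.2| ≤ |w.1 - v.1| := by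
    intro v hv w hw
    have := hlip _ (hF v hv) _ (hF w hw)
    simp only [← sub_div, abs_div, abs_of_pos hN3] at this
    rw [div_le_div_iff_of_pos_right hN3] at this
    exact_mod_cast this
  have hinj : Set.InjOn Prod.fst (F : Set (ℤ × ℤ)) := by
    intro v hv w hw hvw
    have := hlipF v hv w hw
    rw [hvw, sub_self, abs_zero] at this
    exact Prod.ext hvw (sub_eq_zero.1 (abs_nonpos_iff.1 this)).symm
  set X := F.image Prod.fst with hX
  have hXcard : X.card = F.card := Finset.card_image_of_injOn hinj
  have hXF : ∀ t ∈ X, ∃ b, (t, b) ∈ F := by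
    intro t ht
    obtain ⟨v, hv, rfl⟩ := Finset.mem_image.1 ht
    exact ⟨v.2, hv⟩
  choose! Y hY using hXF
  set k := F.card with hk
  set x : ℕ → ℤ := fun j => if h : j < k then X.orderEmbOfFin hXcard ⟨j, h⟩ else 0 with hx
  have hxX : ∀ j < k, x j ∈ X := by
    intro j hj
    simp only [hx, hj, dif_pos]
    exact Finset.orderEmbOfFin_mem _ _ _
  have hxF : ∀ j < k, (x j, Y (x j)) ∈ F := fun j hj => hY _ (hxX j hj)
  have hxlt : ∀ j, j + 1 < k → x j < x (j + 1) := by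
    intro j hj
    have hj' : j < k := by omega
    simp only [hx, hj, hj', dif_pos]
    exact (X.orderEmbOfFin hXcard).strictMono (Fin.mk_lt_mk.2 (Nat.lt_succ_self j))
  refine hN₀ N hN k x (fun j => Y (x j)) ⟨hxlt, ?_, ?_⟩ ?_ ?_
  · intro j hj
    have h1 := hlipF _ (hxF j (by omega)) _ (hxF (j + 1) hj)
    simp only at h1
    rwa [abs_of_pos (sub_pos.2 (hxlt j hj))] at h1
  · intro j hj
    have hp := hF _ (hxF j (by omega))
    have hq := hF _ (hxF (j + 1) (by omega))
    have hr := hF _ (hxF (j + 2) hj)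
    have l1 := hxlt j (by omega)
    have l2 := hxlt (j + 1) hj
    simp only [add_assoc, Nat.reduceAdd] at l2
    simp only at hp hq hr ⊢
    set x₀ := x j
    set x₁ := x (j + 1)
    set x₂ := x (j + 2)
    set y₀ := Y x₀
    set y₁ := Y x₁
    set y₂ := Y x₂
    have l1' : (0 : ℝ) < (x₁ : ℝ) - x₀ := sub_pos.2 (by exact_mod_cast l1)
    have l2' : (0 : ℝ) < (x₂ : ℝ) - x₁ := sub_pos.2 (by exact_mod_cast l2)
    -- compare both slopes with the slope of the supporting line at the middle point
    obtain ⟨m, -, hm⟩ := hsup _ hq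
    have h0 := hm _ hp
    have h2 := hm _ hr
    simp only [← sub_div, mul_div_assoc', ← add_div, div_le_div_iff_of_pos_right hN3] at h0 h2
    have hle : ((y₁ : ℝ) - y₀) * (x₂ - x₁) ≤ (y₂ - y₁) * (x₁ - x₀) := by
      have e0 : (y₁ : ℝ) - y₀ ≤ m * (x₁ - x₀) := by linarith
      have e2 : m * ((x₂ : ℝ) - x₁) ≤ y₂ - y₁ := by linarith
      have := mul_le_mul_of_nonneg_right e0 l2'.le
      have := mul_le_mul_of_nonneg_right e2 l1'.le
      linarith
    have hne' : ((y₁ : ℝ) - y₀) * (x₂ - x₁) ≠ (y₂ - y₁) * (x₁ - x₀) := by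
      intro heq
      have hdist : ∀ u v : ℤ, ∀ b d : ℝ, u < v →
          ((u / N ^ 3, b) : ℝ × ℝ) ≠ ((v / N ^ 3, d) : ℝ × ℝ) := by
        intro u v b d huv he
        have h1 := (Prod.mk.inj he).1
        rw [div_left_inj' hN3.ne'] at h1
        exact huv.ne (by exact_mod_cast h1)
      refine hcol _ hp _ hq _ hr (hdist _ _ _ _ l1) (hdist _ _ _ _ l2)
        (hdist _ _ _ _ (l1.trans l2)) ?_
      simp only [← sub_div, div_mul_div_comm]
      rw [div_eq_zero_iff]
      left
      linear_combination -heq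
    have := lt_of_le_of_ne hle hne'
    exact_mod_cast this
  · intro j hj
    have := hSR _ (hF _ (hxF j hj))
    simp only at this
    rw [abs_div, abs_of_pos hN3, div_le_iff₀ hN3] at this
    exact this
  · intro j hj
    have := hfS _ (hF _ (hxF j hj))
    simp only at this
    rw [this]
    field_simp

/-! ### Lattice points of a strictly convex curve -/

/-- The points of `γ` with a supporting line that, in the coordinates `(pᵢ, s pⱼ)`, has slope in
`[-1, 1]` and bounds `γ` from below. -/
def supportSector (γ : Set Plane) (i j : Fin 2) (s : ℤ) : Set Plane :=
  {p | p ∈ γ ∧ ∃ m : ℝ, |m| ≤ 1 ∧ ∀ q ∈ γ, s * p j + m * (q i - p i) ≤ s * q j}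

lemma exists_mem_supportSector {γ : Set Plane} {p : Plane} (hp : p ∈ γ)
    (h : HasSupportingLineAt γ p) :
    (p ∈ supportSector γ 0 1 1 ∨ p ∈ supportSector γ 0 1 (-1)) ∨
      (p ∈ supportSector γ 1 0 1 ∨ p ∈ supportSector γ 1 0 (-1)) := by
  obtain ⟨u, v, huv, h⟩ := h.exists_coord
  have key : ∀ (a b d e : ℝ), b ≠ 0 → a * d + b * e ≤ 0 →
      (b < 0 → -a / b * d ≤ e) ∧ (0 < b → a / b * d ≤ -e) := by
    intro a b d e _ hle
    constructor
    · intro hb'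
      rw [div_mul_eq_mul_div, div_le_iff_of_neg hb']; linarith
    · intro hb'
      rw [div_mul_eq_mul_div, div_le_iff₀ hb']; linarith
  rcases le_total |u| |v| with huv' | huv'
  · have hv : v ≠ 0 := by
      rintro rfl
      rw [abs_zero, abs_nonpos_iff] at huv'
      simp [huv'] at huv
    have hm : |u / v| ≤ 1 := by
      rw [abs_div]; exact div_le_one_of_le₀ huv' (abs_nonneg _)
    left
    rcases lt_or_gt_of_ne hv with hv' | hv'
    · refine Or.inl ⟨hp, -u / v, by rwa [neg_div, abs_neg], fun q hq => ?_⟩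
      have := (key u v _ _ hv (h q hq)).1 hv'
      push_cast
      linarith
    · refine Or.inr ⟨hp, u / v, hm, fun q hq => ?_⟩
      have := (key u v _ _ hv (h q hq)).2 hv'
      push_cast
      linarith
  · have hu : u ≠ 0 := by
      rintro rfl
      rw [abs_zero, abs_nonpos_iff] at huv'
      simp [huv'] at huv
    have hm : |v / u| ≤ 1 := by
      rw [abs_div]; exact div_le_one_of_le₀ huv' (abs_nonneg _)
    right
    have h' : ∀ q ∈ γ, v * (q 1 - p 1) + u * (q 0 - p 0) ≤ 0 := fun q hq => by
      linarith [h q hq]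
    rcases lt_or_gt_of_ne hu with hu' | hu'
    · refine Or.inl ⟨hp, -v / u, by rwa [neg_div, abs_neg], fun q hq => ?_⟩
      have := (key v u _ _ hu (h' q hq)).1 hu'
      push_cast
      linarith
    · refine Or.inr ⟨hp, v / u, hm, fun q hq => ?_⟩
      have := (key v u _ _ hu (h' q hq)).2 hu'
      push_cast
      linarith

lemma floor_of_mem_scaledLattice {n : ℕ} (hn : 0 < n) {p : Plane} (hp : p ∈ scaledLattice n)
    (i : Fin 2) : p i = (⌊(n : ℝ) * p i⌋ : ℝ) / n := by
  obtain ⟨a, ha⟩ := hp i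
  have hn' : (n : ℝ) ≠ 0 := by exact_mod_cast hn.ne'
  have : (n : ℝ) * p i = a := by rw [ha]; field_simp
  rw [this, Int.floor_intCast, ha]

lemma injOn_floor_scaledLattice {n : ℕ} (hn : 0 < n) :
    Set.InjOn (fun p : Plane => (⌊(n : ℝ) * p 0⌋, ⌊(n : ℝ) * p 1⌋)) (scaledLattice n) := by
  intro p hp q hq hpq
  simp only [Prod.mk.injEq] at hpq
  refine plane_ext ?_ ?_
  · rw [floor_of_mem_scaledLattice hn hp, floor_of_mem_scaledLattice hn hq, hpq.1]
  · rw [floor_of_mem_scaledLattice hn hp, floor_of_mem_scaledLattice hn hq, hpq.2]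

lemma finite_inter_scaledLattice {γ : Set Plane} {R : ℝ} (hR : ∀ p ∈ γ, ∀ i, |p i| ≤ R) {n : ℕ}
    (hn : 0 < n) : (γ ∩ scaledLattice n).Finite := by
  refine Set.Finite.of_finite_image (f := fun p : Plane => (⌊(n : ℝ) * p 0⌋, ⌊(n : ℝ) * p 1⌋)) ?_
    ((injOn_floor_scaledLattice hn).mono Set.inter_subset_right)
  have hfin : ((Set.Icc ⌊-((n : ℝ) * R)⌋ ⌊(n : ℝ) * R⌋) ×ˢ
    (Set.Icc ⌊-((n : ℝ) * R)⌋ ⌊(n : ℝ) * R⌋) : Set (ℤ × ℤ)).Finite :=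
    (Set.finite_Icc _ _).prod (Set.finite_Icc _ _)
  refine hfin.subset ?_
  rintro _ ⟨p, ⟨hp, -⟩, rfl⟩
  have hb : ∀ i, ⌊(n : ℝ) * p i⌋ ∈ Set.Icc ⌊-((n : ℝ) * R)⌋ ⌊(n : ℝ) * R⌋ := by
    intro i
    obtain ⟨h1, h2⟩ := abs_le.1 (hR p hp i)
    refine ⟨Int.floor_mono ?_, Int.floor_mono ?_⟩
    · rw [← mul_neg]; exact mul_le_mul_of_nonneg_left h1 (Nat.cast_nonneg n)
    · exact mul_le_mul_of_nonneg_left h2 (Nat.cast_nonneg n)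
  exact ⟨hb 0, hb 1⟩

lemma exists_card_sector_le {γ : Set Plane} (hγ : IsStrictlyConvexCurve γ) {R c : ℝ} (hR : 0 < R)
    (hγR : ∀ p ∈ γ, ∀ i, |p i| ≤ R) (hc : 0 < c) {i j : Fin 2}
    (hij : (i = 0 ∧ j = 1) ∨ (i = 1 ∧ j = 0)) {s : ℤ} (hs : s = 1 ∨ s = -1) :
    ∃ N₀ : ℝ, ∀ N ≥ N₀, 0 < N → ∀ n : ℕ, N ^ 3 = n → ∀ F : Finset Plane,
      (∀ p ∈ F, p ∈ supportSector γ i j s ∧ p ∈ scaledLattice n) → (F.card : ℝ) ≤ c * N ^ 2 := by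
  classical
  have hs0 : s ≠ 0 := by rcases hs with rfl | rfl <;> norm_num
  have hs0' : (s : ℝ) ≠ 0 := by exact_mod_cast hs0
  have hext : ∀ {p q : Plane}, p i = q i → p j = q j → p = q := by
    rcases hij with ⟨rfl, rfl⟩ | ⟨rfl, rfl⟩
    · exact plane_ext
    · exact fun h1 h2 => plane_ext h2 h1
  set S : Set (ℝ × ℝ) := (fun p : Plane => (p i, s * p j)) '' supportSector γ i j s with hS
  have h1 : ∀ p ∈ S, |p.1| ≤ R := by
    rintro _ ⟨p, hp, rfl⟩
    exact hγR p hp.1 i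
  have h2 : ∀ p ∈ S, ∃ m : ℝ, |m| ≤ 1 ∧ ∀ q ∈ S, p.2 + m * (q.1 - p.1) ≤ q.2 := by
    rintro _ ⟨p, ⟨hp, m, hm, hmq⟩, rfl⟩
    refine ⟨m, hm, ?_⟩
    rintro _ ⟨q, hq, rfl⟩
    exact hmq q hq.1
  have h3 : ∀ p ∈ S, ∀ q ∈ S, ∀ r ∈ S, p ≠ q → q ≠ r → p ≠ r →
      (q.1 - p.1) * (r.2 - p.2) - (q.2 - p.2) * (r.1 - p.1) ≠ 0 := by
    rintro _ ⟨p, hp, rfl⟩ _ ⟨q, hq, rfl⟩ _ ⟨r, hr, rfl⟩ hpq hqr hpr h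
    have hne : cross p q r ≠ 0 := hγ.cross_ne_zero hp.1 hq.1 hr.1
      (fun e => hpq (by rw [e])) (fun e => hqr (by rw [e])) (fun e => hpr (by rw [e]))
    simp only at h
    have h' : (q i - p i) * (r j - p j) - (q j - p j) * (r i - p i) = 0 := by
      have : (s : ℝ) * ((q i - p i) * (r j - p j) - (q j - p j) * (r i - p i)) = 0 := by
        linear_combination h
      exact (mul_eq_zero.1 this).resolve_left hs0'
    rcases hij with ⟨rfl, rfl⟩ | ⟨rfl, rfl⟩
    · exact hne h'
    · exact hne (by simp only [cross]; linear_combination -h')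
  obtain ⟨N₀, hN₀⟩ := exists_card_le_of_support (S := S) hR hc h1 h2 h3
  refine ⟨N₀, fun N hN hNpos n hn F hF => ?_⟩
  have hnpos : 0 < n := by
    have : (0 : ℝ) < n := by rw [← hn]; positivity
    exact_mod_cast this
  have hcard : (F.image fun p : Plane => (⌊(n : ℝ) * p i⌋, s * ⌊(n : ℝ) * p j⌋)).card
      = F.card := by
    refine Finset.card_image_of_injOn fun p hp q hq hpq => ?_
    simp only [Prod.mk.injEq] at hpq
    have h2 := mul_left_cancel₀ hs0 hpq.2
    refine hext ?_ ?_
    · rw [floor_of_mem_scaledLattice hnpos (hF p hp).2,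
        floor_of_mem_scaledLattice hnpos (hF q hq).2, hpq.1]
    · rw [floor_of_mem_scaledLattice hnpos (hF p hp).2,
        floor_of_mem_scaledLattice hnpos (hF q hq).2, h2]
  rw [← hcard]
  refine hN₀ N hN hNpos _ fun v hv => ?_
  obtain ⟨p, hp, rfl⟩ := Finset.mem_image.1 hv
  refine ⟨p, (hF p hp).1, ?_⟩
  simp only [hn]
  refine Prod.ext ?_ ?_
  · exact floor_of_mem_scaledLattice hnpos (hF p hp).2 i
  · have := floor_of_mem_scaledLattice hnpos (hF p hp).2 j
    simp only
    push_cast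
    rw [mul_div_assoc, ← this]

lemma isLittleO_latticeCount {γ : Set Plane} (hγ : IsStrictlyConvexCurve γ) {R : ℝ} (hR : 0 < R)
    (hγR : ∀ p ∈ γ, ∀ i, |p i| ≤ R) :
    (fun n : ℕ => (latticeCount γ n : ℝ)) =o[atTop] (fun n : ℕ => (n : ℝ) ^ (2 / 3 : ℝ)) := by
  classical
  rw [isLittleO_iff]
  intro c hc
  have hc4 : 0 < c / 4 := by positivity
  obtain ⟨N₁, h₁⟩ := exists_card_sector_le hγ hR hγR hc4 (i := 0) (j := 1) (Or.inl ⟨rfl, rfl⟩)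
    (s := 1) (Or.inl rfl)
  obtain ⟨N₂, h₂⟩ := exists_card_sector_le hγ hR hγR hc4 (i := 0) (j := 1) (Or.inl ⟨rfl, rfl⟩)
    (s := -1) (Or.inr rfl)
  obtain ⟨N₃, h₃⟩ := exists_card_sector_le hγ hR hγR hc4 (i := 1) (j := 0) (Or.inr ⟨rfl, rfl⟩)
    (s := 1) (Or.inl rfl)
  obtain ⟨N₄, h₄⟩ := exists_card_sector_le hγ hR hγR hc4 (i := 1) (j := 0) (Or.inr ⟨rfl, rfl⟩)
    (s := -1) (Or.inr rfl)
  have htend : Tendsto (fun n : ℕ => (n : ℝ) ^ (1 / 3 : ℝ)) atTop atTop :=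
    (tendsto_rpow_atTop (by norm_num)).comp tendsto_natCast_atTop_atTop
  filter_upwards [htend.eventually_ge_atTop N₁, htend.eventually_ge_atTop N₂,
    htend.eventually_ge_atTop N₃, htend.eventually_ge_atTop N₄, eventually_gt_atTop 0]
    with n g₁ g₂ g₃ g₄ hn
  have hn' : (0 : ℝ) < n := by exact_mod_cast hn
  set N : ℝ := (n : ℝ) ^ (1 / 3 : ℝ) with hN
  have hNpos : 0 < N := Real.rpow_pos_of_pos hn' _
  have hN3 : N ^ 3 = n := by
    rw [hN, ← Real.rpow_natCast, ← Real.rpow_mul hn'.le]; norm_num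
  have hN2 : N ^ 2 = (n : ℝ) ^ (2 / 3 : ℝ) := by
    rw [hN, ← Real.rpow_natCast, ← Real.rpow_mul hn'.le]; norm_num
  have hfin := finite_inter_scaledLattice hγR hn
  set K := hfin.toFinset with hK
  have hKcard : latticeCount γ n = K.card := Set.ncard_eq_toFinset_card _ hfin
  have hmem : ∀ p, p ∈ K → p ∈ γ ∧ p ∈ scaledLattice n := fun p hp => hfin.mem_toFinset.1 hp
  have hsec : ∀ (i j : Fin 2) (s : ℤ), ∀ p ∈ K.filter (· ∈ supportSector γ i j s),
      p ∈ supportSector γ i j s ∧ p ∈ scaledLattice n := fun i j s p hp =>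
    ⟨(Finset.mem_filter.1 hp).2, (hmem p (Finset.mem_filter.1 hp).1).2⟩
  have d₁ := h₁ N g₁ hNpos n hN3 _ (hsec 0 1 1)
  have d₂ := h₂ N g₂ hNpos n hN3 _ (hsec 0 1 (-1))
  have d₃ := h₃ N g₃ hNpos n hN3 _ (hsec 1 0 1)
  have d₄ := h₄ N g₄ hNpos n hN3 _ (hsec 1 0 (-1))
  have hcover : K ⊆ (K.filter (· ∈ supportSector γ 0 1 1) ∪
      K.filter (· ∈ supportSector γ 0 1 (-1))) ∪ (K.filter (· ∈ supportSector γ 1 0 1) ∪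
      K.filter (· ∈ supportSector γ 1 0 (-1))) := by
    intro p hp
    have hpγ := (hmem p hp).1
    simp only [Finset.mem_union, Finset.mem_filter, hp, true_and]
    exact exists_mem_supportSector hpγ (hγ.1.2 p hpγ)
  have hle : K.card ≤ ((K.filter (· ∈ supportSector γ 0 1 1)).card +
      (K.filter (· ∈ supportSector γ 0 1 (-1))).card) +
      ((K.filter (· ∈ supportSector γ 1 0 1)).card +
      (K.filter (· ∈ supportSector γ 1 0 (-1))).card) :=
    (Finset.card_le_card hcover).trans ((Finset.card_union_le _ _).trans
      (add_le_add (Finset.card_union_le _ _) (Finset.card_union_le _ _)))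
  have hle' : (K.card : ℝ) ≤ (((K.filter (· ∈ supportSector γ 0 1 1)).card : ℝ) +
      (K.filter (· ∈ supportSector γ 0 1 (-1))).card) +
      (((K.filter (· ∈ supportSector γ 1 0 1)).card : ℝ) +
      (K.filter (· ∈ supportSector γ 1 0 (-1))).card) := by exact_mod_cast hle
  rw [hKcard, Real.norm_of_nonneg (Nat.cast_nonneg _), ← hN2,
    Real.norm_of_nonneg (by positivity)]
  linarith

theorem mainTheorem1 :
    (∀ γ : Set Plane, IsStrictlyConvexCurve γ → Bornology.IsBounded γ →
      (∀ n : ℕ, 0 < n → (γ ∩ scaledLattice n).Finite) ∧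
      (fun n : ℕ => (latticeCount γ n : ℝ)) =o[atTop] (fun n : ℕ => (n : ℝ) ^ (2 / 3 : ℝ))) ∧
    ¬ ∃ γ : Set Plane, IsUniversalJarnikCurve γ := by
  have hbound : ∀ γ : Set Plane, Bornology.IsBounded γ →
      ∃ R : ℝ, 0 < R ∧ ∀ p ∈ γ, ∀ i, |p i| ≤ R := by
    intro γ hγ
    obtain ⟨R, hR, h⟩ := hγ.exists_pos_norm_le
    exact ⟨R, hR, fun p hp i => (PiLp.norm_apply_le p i).trans (h p hp)⟩
  refine ⟨fun γ hγ hb => ?_, ?_⟩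
  · obtain ⟨R, hR, hγR⟩ := hbound γ hb
    exact ⟨fun n hn => finite_inter_scaledLattice hγR hn, isLittleO_latticeCount hγ hR hγR⟩
  · rintro ⟨γ, hγ, hb, c, hc, hinf⟩
    obtain ⟨R, hR, hγR⟩ := hbound γ hb
    have hlo := (isLittleO_iff.1 (isLittleO_latticeCount hγ hR hγR)) (half_pos hc)
    obtain ⟨M, hM⟩ := eventually_atTop.1 hlo
    obtain ⟨n, ⟨hn, hcn⟩, hMn⟩ := hinf.exists_gt M
    have h := hM n hMn.le
    have hpos : 0 < (n : ℝ) ^ (2 / 3 : ℝ) := Real.rpow_pos_of_pos (by exact_mod_cast hn) _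
    rw [Real.norm_of_nonneg (Nat.cast_nonneg _), Real.norm_of_nonneg hpos.le] at h
    nlinarith
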